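/- For real $y$ and a positive integer $n$ let $\omega_y(n)$ be the number of distinct primes $p<y$ dividing $n$, and let $N_k(x,y)$ be the number of positive integers $n\le x$ with $\omega_y(n)=k$. Put $\alpha=\log x/\log y$ and $$\ell(z)=e^{(z-1)\gamma}\prod_{p}\left(1+\frac{z-1}{p}\right)\left(1-\frac1p\right)^{z-1}\qquad(z\in\mathbb{C}),$$ where the product is over all primes and $\gamma$ is Euler's constant. Theorem. There exists an absolute constant $C>0$ with the following property. For every $r>0$, $$N_k(x,y)=\ell\left(\frac{k}{\log\log y}\right)\frac{x}{\log y}\,\frac{(\log\log y)^k}{k!}\left(1+O_r\left(\frac{k}{(\log\log y)^2}\right)\right)$$ uniformly for all real $x\ge y>1$ with $\alpha>C\log\log x$ and all integers $k$ with $1\le k\le r\log\log y$; the implied constant depends only on $r$. -/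

import Mathlib

/-- `omegaBelow y n` is the number of distinct primes `p` with `p ∣ n` and `p < y`
(used for `n ≥ 1`). -/
noncomputable def omegaBelow (y : ℝ) (n : ℕ) : ℕ :=
  (n.primeFactors.filter (fun p : ℕ => (p : ℝ) < y)).card

/-- `countBelow k x y` is the number of positive integers `n ≤ x` having exactly `k` distinct
prime factors smaller than `y`. -/
noncomputable def countBelow (k : ℕ) (x y : ℝ) : ℕ :=
  ((Finset.Icc 1 ⌊x⌋₊).filter (fun n : ℕ => omegaBelow y n = k)).card

/-- The entire function
`ell z = e ^ ((z - 1) γ) ∏ₚ (1 + (z - 1) / p) (1 - 1 / p) ^ (z - 1)`, the product being over all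
primes (its general factor is `1 + O(1 / p ^ 2)`) and `γ` being Euler's constant. -/
noncomputable def ell (z : ℂ) : ℂ :=
  Complex.exp ((z - 1) * (Real.eulerMascheroniConstant : ℂ)) *
    ∏' p : Nat.Primes,
      (1 + (z - 1) / ((p : ℕ) : ℂ)) * (1 - 1 / ((p : ℕ) : ℂ)) ^ (z - 1)

/-! Write `L = log log y`. Expanding each factor of `z ^ ω_y(n)` as `1 + (z - 1)` turns it into a
sum of `(z - 1) ^ ω(d)` over squarefree `d ∣ n` composed of primes below `y`. Summing over `n ≤ x`
and dropping the fractional part of `x / d` leaves `x P(z)` with `P(z) = ∏_{p<y} (1 + (z - 1) / p)`,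
which is `densityPoly`. The fractional parts are handled by Rankin's trick
(`abs_countBelow_sub_mul_pow_le`): with exponent `σ = 1 - c / log y` the error is `x ^ σ (log y) ^
O_r(1)`. Since `log x / log y > log log x ≥ log log y`, the gain `x ^ (-c / log y)` is at most `(log
y) ^ (-c)`, and a `c` depending on `r` wins (`exists_abs_countBelow_sub_le`).

The coefficient of `z ^ k` in `P` is found without contour asymptotics (`exists_norm_coeff_sub_le`).
Put `F(z) = P(z) e ^ (-zL)`, with Taylor coefficients `a_j`. The coefficient is `L ^ k / k!` times
`∑ a_j k(k-1)⋯(k-j+1) / L ^ j`. Replacing the falling factorial by `k ^ j` changes nothing for `j ≤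
1` and costs `O(k / L ^ 2)` relative to the size of `F` on `|z| = 2r`; the new sum is `F(k / L)`.

Mertens' theorems give `F = O(1 / log y)` on that circle and `F(ρ) = ell(ρ) / log y + O(1 / log y ^
2)` for `0 ≤ ρ ≤ r`. The last estimate needs the exact constant in Mertens' second theorem,
identified in `mertens_constant_eq` from the behaviour of zeta at `1`. Finally `1 / log y = O(k / L
^ 2)`, and `ell` is bounded away from `0` on `[0, r]`, so the additive error becomes a relative one.
-/

/-! ### Mertens' first theorem from the factorization of `n!` -/

/-- The logarithm of a factorial in terms of the exponents of its prime factorization. -/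
lemma log_factorial_eq_sum_primesLE (n : ℕ) :
    Real.log (n.factorial : ℝ) =
      ∑ p ∈ n.primesLE, (n.factorial.factorization p : ℝ) * Real.log p := by
  rw [Real.log_nat_eq_sum_factorization]
  refine Finsupp.sum_of_support_subset _ (fun p hp => ?_) _ (by simp)
  have hp' := Nat.prime_of_mem_primeFactors (Nat.support_factorization _ ▸ hp)
  have hd := Nat.dvd_of_mem_primeFactors (Nat.support_factorization _ ▸ hp)
  exact Nat.mem_primesLE.2 ⟨(hp'.dvd_factorial).1 hd, hp'⟩

/-- Legendre's formula in digit-sum form: `(p - 1) v_p(n!)` is `n` minus the sum of the base `p`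
digits of `n`. -/
lemma factorization_factorial_le_div {n p : ℕ} (hp : p.Prime) :
    (n.factorial.factorization p : ℝ) ≤ n / (p - 1 : ℝ) := by
  have h := Nat.sub_one_mul_factorization_factorial (n := n) hp
  have h2 : (p - 1) * n.factorial.factorization p ≤ n := h ▸ Nat.sub_le _ _
  have h3 : ((p - 1 : ℕ) : ℝ) * (n.factorial.factorization p : ℝ) ≤ n := by exact_mod_cast h2
  rw [Nat.cast_sub hp.one_le, Nat.cast_one] at h3
  have : (1 : ℝ) < p := by exact_mod_cast hp.one_lt
  rw [le_div_iff₀ (by linarith)]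
  linarith

lemma div_sub_one_le_factorization_factorial {n p : ℕ} (hp : p.Prime) :
    (n / p - 1 : ℝ) ≤ (n.factorial.factorization p : ℝ) := by
  have h := Nat.factorization_factorial hp (n := n) (b := Nat.log p n + 2) (by omega)
  have h1 : n / p ≤ n.factorial.factorization p := by
    rw [h]
    simpa using Finset.single_le_sum (f := fun i => n / p ^ i) (fun _ _ => Nat.zero_le _)
      (Finset.mem_Ico.2 ⟨le_rfl, by omega⟩ : 1 ∈ Finset.Ico 1 (Nat.log p n + 2))
  have h2 : ((n / p : ℕ) : ℝ) ≤ n.factorial.factorization p := by exact_mod_cast h1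
  have h3 := Nat.lt_floor_add_one ((n : ℝ) / p)
  rw [Nat.floor_div_eq_div] at h3
  linarith

lemma log_nat_le_two_mul_sqrt (n : ℕ) : Real.log n ≤ 2 * Real.sqrt n := by
  have := Real.log_le_rpow_div (Nat.cast_nonneg n : (0 : ℝ) ≤ n) (ε := 1 / 2) (by norm_num)
  rw [← Real.sqrt_eq_rpow] at this
  linarith

lemma summable_sqrt_div_sq : Summable fun n : ℕ => Real.sqrt n / (n : ℝ) ^ 2 := by
  refine (Real.summable_nat_rpow.2 (by norm_num : (-3 / 2 : ℝ) < -1)).congr fun n => ?_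
  rcases Nat.eq_zero_or_pos n with rfl | hn
  · simp [Real.zero_rpow (by norm_num : (-3 / 2 : ℝ) ≠ 0)]
  · have : (0 : ℝ) < n := by exact_mod_cast hn
    rw [Real.sqrt_eq_rpow, ← Real.rpow_natCast, ← Real.rpow_sub this]
    norm_num

/-- Mertens' first theorem. -/
theorem exists_abs_sum_log_div_sub_log_le :
    ∃ B : ℝ, 0 < B ∧ ∀ n : ℕ, 1 ≤ n →
      |∑ p ∈ n.primesLE, Real.log p / p - Real.log n| ≤ B := by
  set T : ℝ := ∑' n : ℕ, Real.sqrt n / (n : ℝ) ^ 2 with hT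
  have hT0 : 0 ≤ T := tsum_nonneg fun n => by positivity
  refine ⟨Real.log 4 + (1 + 4 * T), by positivity, fun n hn => ?_⟩
  have hn0 : (0 : ℝ) < n := by exact_mod_cast hn
  have hl4 : 0 ≤ Real.log 4 := Real.log_nonneg (by norm_num)
  rw [abs_le]
  constructor
  · have h1 : Real.log n.factorial ≤
        n * (∑ p ∈ n.primesLE, Real.log p / p + 4 * T) := by
      have h2 : ∑ p ∈ n.primesLE, 4 * (Real.sqrt p / (p : ℝ) ^ 2) ≤ 4 * T := by
        rw [← Finset.mul_sum]
        gcongr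
        exact summable_sqrt_div_sq.sum_le_tsum _ (fun _ _ => by positivity)
      calc Real.log n.factorial
          = ∑ p ∈ n.primesLE, (n.factorial.factorization p : ℝ) * Real.log p :=
            log_factorial_eq_sum_primesLE n
        _ ≤ ∑ p ∈ n.primesLE, n * (Real.log p / p + 4 * (Real.sqrt p / (p : ℝ) ^ 2)) := by
            refine Finset.sum_le_sum fun p hp => ?_
            have hp' := Nat.prime_of_mem_primesLE hp
            have hp2 : (2 : ℝ) ≤ p := by exact_mod_cast hp'.two_le
            have hlog : 0 ≤ Real.log p := Real.log_nonneg (by linarith)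
            calc (n.factorial.factorization p : ℝ) * Real.log p
                ≤ n / (p - 1 : ℝ) * Real.log p := by
                  gcongr; exact factorization_factorial_le_div hp'
              _ = n * (Real.log p / p + Real.log p / (p * (p - 1))) := by
                  have : (p : ℝ) - 1 ≠ 0 := by linarith
                  field_simp
                  ring
              _ ≤ _ := by
                  gcongr
                  have := log_nat_le_two_mul_sqrt p
                  rw [← mul_div_assoc, div_le_div_iff₀ (by nlinarith) (by positivity)]
                  calc Real.log p * (p : ℝ) ^ 2 ≤ (2 * Real.sqrt p) * (2 * (p * (p - 1))) := by
                        gcongr; nlinarith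
                    _ = _ := by ring
        _ ≤ _ := by
            rw [← Finset.mul_sum, Finset.sum_add_distrib]
            gcongr
    have h3 := Stirling.le_log_factorial_stirling (n := n) (by omega)
    have h4 : 0 ≤ Real.log (2 * Real.pi) := Real.log_nonneg (by linarith [Real.pi_gt_three])
    have h5 : 0 ≤ Real.log n := Real.log_nonneg (by exact_mod_cast hn)
    have h6 : n * (Real.log n - 1) ≤ n * (∑ p ∈ n.primesLE, Real.log p / p + 4 * T) := by
      linarith
    have := le_of_mul_le_mul_left h6 hn0
    linarith
  -- Replacing `n / p` by the exponent of `p` in `n!` loses at most `1` per prime, hence `θ(n)` in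
  -- total, which Chebyshev's bound makes `O(n)`.
  · have h1 : n * ∑ p ∈ n.primesLE, Real.log p / p ≤
        Real.log n.factorial + Real.log 4 * n := by
      have h2 := Chebyshev.theta_le_log4_mul_x (x := n) hn0.le
      rw [Chebyshev.theta_eq_sum_primesLE_log] at h2
      calc n * ∑ p ∈ n.primesLE, Real.log p / p
          = ∑ p ∈ n.primesLE, (((n : ℝ) / p - 1) * Real.log p + Real.log p) := by
            rw [Finset.mul_sum]
            exact Finset.sum_congr rfl fun p _ => by ring
        _ ≤ ∑ p ∈ n.primesLE, ((n.factorial.factorization p : ℝ) * Real.log p + Real.log p) := by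
            refine Finset.sum_le_sum fun p hp => ?_
            have hp' := Nat.prime_of_mem_primesLE hp
            have hlog : 0 ≤ Real.log p := Real.log_natCast_nonneg p
            gcongr
            exact div_sub_one_le_factorization_factorial hp'
        _ ≤ _ := by
            rw [Finset.sum_add_distrib, ← log_factorial_eq_sum_primesLE]
            gcongr
    have h3 : Real.log n.factorial ≤ n * Real.log n := by
      rw [← Real.log_pow]
      exact Real.log_le_log (by exact_mod_cast n.factorial_pos)
        (by exact_mod_cast Nat.factorial_le_pow n)
    have h6 : n * ∑ p ∈ n.primesLE, Real.log p / p ≤ n * (Real.log n + Real.log 4) := by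
      linarith
    have := le_of_mul_le_mul_left h6 hn0
    linarith

/-! ### Mertens' second theorem by partial summation -/

lemma sum_primesLE_succ (f : ℕ → ℝ) (n : ℕ) :
    ∑ p ∈ (n + 1).primesLE, f p = ∑ p ∈ n.primesLE, f p + if (n + 1).Prime then f (n + 1) else 0 := by
  simp only [Nat.primesLE_eq_filter_range, Finset.sum_filter, Finset.sum_range_succ _ (n + 1)]

lemma log_succ_sub_log_le {n : ℕ} (hn : 1 ≤ n) :
    Real.log (n + 1 : ℕ) - Real.log n ≤ 1 / n := by
  have hn0 : (0 : ℝ) < n := by exact_mod_cast hn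
  rw [← Real.log_div (by positivity) (by positivity)]
  refine (Real.log_le_sub_one_of_pos (by positivity)).trans (le_of_eq ?_)
  push_cast
  field_simp
  ring

lemma log_two_pos_le_log {n : ℕ} (hn : 2 ≤ n) : Real.log 2 ≤ Real.log n :=
  Real.log_le_log (by norm_num) (by exact_mod_cast hn)

/-- Both sides follow from `1 - 1 / t ≤ log t ≤ t - 1` at `t = 1 - q`. Negative `q` of any size is
allowed, so that `q = -w / p` with `w` large is covered. -/
lemma abs_add_log_one_sub_le {q : ℝ} (h1 : q ≤ 1 / 2) :
    |q + Real.log (1 - q)| ≤ 2 * q ^ 2 := by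
  have h2 := Real.log_le_sub_one_of_pos (by linarith : 0 < 1 - q)
  have h3 := Real.one_sub_inv_le_log_of_pos (by linarith : 0 < 1 - q)
  rw [abs_le]
  constructor
  · have : (1 - q)⁻¹ ≤ 1 + q + 2 * q ^ 2 := by
      rw [inv_le_iff_one_le_mul₀ (by linarith)]
      nlinarith [mul_nonneg (sq_nonneg q) (by linarith : 0 ≤ 1 - 2 * q)]
    linarith
  · nlinarith

/-- One step of the partial summation that derives Mertens' second theorem from the first. -/
lemma abs_step_sum_inv_sub_loglog {B : ℝ}
    (hB : ∀ n : ℕ, 1 ≤ n → |∑ p ∈ n.primesLE, Real.log p / p - Real.log n| ≤ B)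
    {n : ℕ} (hn : 2 ≤ n) :
    |(∑ p ∈ (n + 1).primesLE, (1 : ℝ) / p - Real.log (Real.log (n + 1 : ℕ))
        - (∑ p ∈ (n + 1).primesLE, Real.log p / p - Real.log (n + 1 : ℕ)) / Real.log (n + 1 : ℕ))
      - (∑ p ∈ n.primesLE, (1 : ℝ) / p - Real.log (Real.log n)
        - (∑ p ∈ n.primesLE, Real.log p / p - Real.log n) / Real.log n)| ≤
      (B + 2) * (1 / Real.log n - 1 / Real.log (n + 1 : ℕ)) := by
  set l := Real.log n with hl
  set m := Real.log (n + 1 : ℕ) with hm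
  have hl0 : 0 < l := (Real.log_pos (by norm_num)).trans_le (log_two_pos_le_log hn)
  have hlm : l ≤ m := Real.log_le_log (by positivity) (by exact_mod_cast n.le_succ)
  have hm0 : 0 < m := hl0.trans_le hlm
  have hn0 : (2 : ℝ) ≤ n := by exact_mod_cast hn
  have hstep : m - l ≤ 1 / n := log_succ_sub_log_le (by omega)
  have hlog : l ≤ n := (Real.log_le_self (by positivity))
  have hml : m ≤ 2 * l := by
    rw [hl, hm, two_mul, ← Real.log_mul (by positivity) (by positivity)]
    refine Real.log_le_log (by positivity) ?_
    push_cast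
    nlinarith
  set q := 1 - l / m with hq
  have hq0 : 0 ≤ q := by rw [hq, sub_nonneg, div_le_one hm0]; exact hlm
  have hq1 : q ≤ 1 / 2 := by
    have : (1 : ℝ) / 2 ≤ l / m := by rw [le_div_iff₀ hm0]; linarith
    linarith
  have hqe : q = l * (1 / l - 1 / m) := by rw [hq]; field_simp
  have hd0 : 0 ≤ 1 / l - 1 / m := sub_nonneg.2 (one_div_le_one_div_of_le hl0 hlm)
  -- One factor `q` equals `l (1 / l - 1 / m)` and the other satisfies `q l ≤ 1`, so the quadratic
  -- error is dominated by a telescoping term.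
  have hq2 : q ^ 2 ≤ 1 / l - 1 / m := by
    have h1 : q * l ≤ 1 := by
      have : q * l = l * (m - l) / m := by rw [hq]; field_simp
      rw [this, div_le_one hm0]
      have : l * (m - l) ≤ l * (1 / 1) := by
        gcongr
        exact hstep.trans (one_div_le_one_div_of_le one_pos (by linarith))
      linarith
    calc q ^ 2 = (q * l) * (1 / l - 1 / m) := by rw [sq]; nth_rw 2 [hqe]; ring
      _ ≤ 1 * (1 / l - 1 / m) := by gcongr
      _ = _ := one_mul _
  set A := ∑ p ∈ n.primesLE, Real.log p / p with hA
  have hs : (if (n + 1).Prime then (1 : ℝ) / (n + 1 : ℕ) else 0) =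
      (if (n + 1).Prime then Real.log (n + 1 : ℕ) / (n + 1 : ℕ) else 0) / m := by
    split_ifs
    · rw [← hm]; field_simp
    · simp
  rw [sum_primesLE_succ (fun p => (1 : ℝ) / p), sum_primesLE_succ (fun p => Real.log p / p),
    ← hA, hs]
  set a := (if (n + 1).Prime then Real.log (n + 1 : ℕ) / (n + 1 : ℕ) else 0)
  have hlogq : Real.log (1 - q) = Real.log l - Real.log m := by
    rw [← Real.log_div hl0.ne' hm0.ne', hq]; ring_nf
  -- The contribution `a / m` of a possible new prime cancels; what remains is a second-order
  -- logarithmic error and the bounded `A - l` against a telescoping weight.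
  have key : (∑ p ∈ n.primesLE, (1 : ℝ) / p + a / m - Real.log m - (A + a - m) / m) -
      (∑ p ∈ n.primesLE, (1 : ℝ) / p - Real.log l - (A - l) / l) =
      (q + Real.log (1 - q)) + (A - l) * (1 / l - 1 / m) := by
    rw [hlogq, hq]; field_simp; ring
  rw [key]
  calc |(q + Real.log (1 - q)) + (A - l) * (1 / l - 1 / m)|
      ≤ |q + Real.log (1 - q)| + |A - l| * (1 / l - 1 / m) := by
        refine (abs_add_le _ _).trans ?_
        rw [abs_mul, abs_of_nonneg hd0]
    _ ≤ 2 * (1 / l - 1 / m) + B * (1 / l - 1 / m) := by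
        gcongr
        · exact (abs_add_log_one_sub_le hq1).trans (by linarith)
        · exact hB n (by omega)
    _ = _ := by ring

/-- A sequence whose steps are dominated by those of an antitone nonnegative sequence converges, at
the corresponding rate. -/
lemma exists_abs_sub_le_of_abs_step_le {f g : ℕ → ℝ} {N : ℕ} (hg : ∀ n, N ≤ n → 0 ≤ g n)
    (h : ∀ n, N ≤ n → |f (n + 1) - f n| ≤ g n - g (n + 1)) :
    ∃ M : ℝ, ∀ n, N ≤ n → |f n - M| ≤ g n := by
  have hanti : ∀ i n, N ≤ n → |f (n + i) - f n| ≤ g n - g (n + i) := by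
    intro i
    induction i with
    | zero => intro n _; simp
    | succ i ih =>
      intro n hn
      have h1 := ih n hn
      have h2 := h (n + i) (by omega)
      rw [← add_assoc]
      have h3 := abs_sub_le (f (n + i + 1)) (f (n + i)) (f n)
      linarith
  -- From `N` on, `f - g` increases and `f + g` decreases, so every value of the former lies below
  -- every value of the latter; the supremum of the former is trapped between the two.
  refine ⟨⨆ i, (f (N + i) - g (N + i)), fun n hn => ?_⟩
  obtain ⟨j, rfl⟩ := Nat.exists_eq_add_of_le hn
  have hle : ∀ i, f (N + i) - g (N + i) ≤ f (N + j) + g (N + j) := by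
    intro i
    rcases le_total i j with hij | hij
    · obtain ⟨d, rfl⟩ := Nat.exists_eq_add_of_le hij
      have h1 := hanti d (N + i) (by omega)
      have h2 := hg (N + i + d) (by omega)
      rw [← add_assoc]
      linarith [abs_le.1 h1]
    · obtain ⟨d, rfl⟩ := Nat.exists_eq_add_of_le hij
      have h1 := hanti d (N + j) (by omega)
      have h2 := hg (N + j + d) (by omega)
      rw [← add_assoc]
      linarith [abs_le.1 h1]
  have h1 := ciSup_le hle
  have h2 : f (N + j) - g (N + j) ≤ ⨆ i, (f (N + i) - g (N + i)) :=
    le_ciSup (f := fun i => f (N + i) - g (N + i)) ⟨_, by rintro _ ⟨i, rfl⟩; exact hle i⟩ j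
  rw [abs_le]
  constructor <;> linarith

/-- Mertens' second theorem, with an unspecified constant. -/
theorem exists_abs_sum_inv_sub_loglog_sub_le :
    ∃ M K : ℝ, 0 < K ∧ ∀ n : ℕ, 2 ≤ n →
      |∑ p ∈ n.primesLE, (1 : ℝ) / p - Real.log (Real.log n) - M| ≤ K / Real.log n := by
  obtain ⟨B, hB0, hB⟩ := exists_abs_sum_log_div_sub_log_le
  have hpos : ∀ n : ℕ, 2 ≤ n → 0 < Real.log n := fun n hn =>
    (Real.log_pos (by norm_num)).trans_le (log_two_pos_le_log hn)
  obtain ⟨M, hM⟩ := exists_abs_sub_le_of_abs_step_le (N := 2)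
    (f := fun n => ∑ p ∈ n.primesLE, (1 : ℝ) / p - Real.log (Real.log n)
        - (∑ p ∈ n.primesLE, Real.log p / p - Real.log n) / Real.log n)
    (g := fun n => (B + 2) / Real.log n)
    (fun n hn => div_nonneg (by linarith) (hpos n hn).le)
    (fun n hn => (abs_step_sum_inv_sub_loglog hB hn).trans (le_of_eq (by ring)))
  refine ⟨M, 2 * B + 2, by linarith, fun n hn => ?_⟩
  have h1 := hM n hn
  have h2 : |(∑ p ∈ n.primesLE, Real.log p / p - Real.log n) / Real.log n| ≤ B / Real.log n := by
    rw [abs_div, abs_of_pos (hpos n hn)]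
    have := (hpos n hn).le
    gcongr
    exact hB n (by omega)
  have h3 : (2 * B + 2) / Real.log n = (B + 2) / Real.log n + B / Real.log n := by ring
  rw [h3]
  rw [abs_le] at h1 h2 ⊢
  constructor <;> linarith [h1.1, h1.2, h2.1, h2.2]

/-! ### The constant in Mertens' second theorem, from zeta near `1` -/

open Filter Topology in
/-- An Abelian theorem for Dirichlet series at `δ → 0⁺`. -/
theorem tendsto_dirichletSeries_of_tendsto_sum {d : ℕ → ℝ} {l : ℝ} {D : ℝ → ℝ}
    (hd : Tendsto (fun N => ∑ i ∈ Finset.range N, d i) atTop (𝓝 l))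
    (hD : ∀ δ : ℝ, 0 < δ → HasSum (fun i : ℕ => d i * ((i : ℝ) + 1) ^ (-δ)) (D δ)) :
    Tendsto D (𝓝[>] 0) (𝓝 l) := by
  set C : ℕ → ℝ := fun N => ∑ i ∈ Finset.range N, d i with hC
  obtain ⟨K, hK⟩ : ∃ K, ∀ n, |C n - l| ≤ K := by
    obtain ⟨K, hK⟩ := (hd.sub_const l).abs.bddAbove_range
    exact ⟨K, fun n => hK ⟨n, rfl⟩⟩
  have hK0 : 0 ≤ K := (abs_nonneg _).trans (hK 0)
  rw [Metric.tendsto_nhds]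
  intro ε hε
  obtain ⟨N₀, hN₀⟩ := (Metric.tendsto_atTop.1 hd) (ε / 3) (by positivity)
  have hcont : Tendsto (fun δ : ℝ => K * (1 - ((N₀ : ℝ) + 1) ^ (-δ))) (𝓝[>] 0) (𝓝 0) := by
    have h1 : Continuous fun δ : ℝ => K * (1 - ((N₀ : ℝ) + 1) ^ (-δ)) :=
      continuous_const.mul (continuous_const.sub
        (Real.continuous_const_rpow (by positivity) |>.comp continuous_neg))
    simpa using (h1.tendsto 0).mono_left nhdsWithin_le_nhds
  filter_upwards [self_mem_nhdsWithin, hcont.eventually (gt_mem_nhds (by positivity : 0 < ε / 3))]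
    with δ hδ hsmall
  have hδ0 : (0 : ℝ) < δ := hδ
  set t : ℕ → ℝ := fun i => ((i : ℝ) + 1) ^ (-δ) with ht
  have ht0 : ∀ i, 0 ≤ t i := fun i => by positivity
  have htanti : ∀ i, t (i + 1) ≤ t i := fun i =>
    Real.rpow_le_rpow_of_nonpos (by positivity) (by push_cast; linarith) (by linarith)
  have ht1 : t 0 = 1 := by simp [ht]
  -- Abel summation: `R` accumulates `C - l` weighted by the decrements of `t`. Up to `N₀` this is
  -- at most `K (1 - t N₀)`, which vanishes as `δ → 0`; beyond `N₀` the weights telescope against `ε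
  -- / 3`.
  set R : ℕ → ℝ := fun N => ∑ i ∈ Finset.range N, d i * t i - C N * t N - l * (1 - t N) with hR
  have hstep : ∀ N, R (N + 1) = R N + (C (N + 1) - l) * (t N - t (N + 1)) := by
    intro N
    simp only [hR, hC, Finset.sum_range_succ]
    ring
  have hR1 : ∀ N, |R N| ≤ K * (1 - t N) := by
    intro N
    induction N with
    | zero => simp [hR, hC, ht1]
    | succ N ih =>
      rw [hstep]
      refine (abs_add_le _ _).trans ?_
      rw [abs_mul, abs_of_nonneg (sub_nonneg.2 (htanti N))]
      have := mul_le_mul_of_nonneg_right (hK (N + 1)) (sub_nonneg.2 (htanti N))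
      linarith
  have hR2 : ∀ j, |R (N₀ + j)| ≤ K * (1 - t N₀) + ε / 3 * (t N₀ - t (N₀ + j)) := by
    intro j
    induction j with
    | zero => simpa using hR1 N₀
    | succ j ih =>
      rw [← add_assoc, hstep]
      refine (abs_add_le _ _).trans ?_
      rw [abs_mul, abs_of_nonneg (sub_nonneg.2 (htanti _))]
      have h1 : |C (N₀ + j + 1) - l| ≤ ε / 3 := by
        have := hN₀ (N₀ + j + 1) (by omega)
        rw [Real.dist_eq] at this
        exact this.le
      have := mul_le_mul_of_nonneg_right h1 (sub_nonneg.2 (htanti (N₀ + j)))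
      linarith
  have hfin : ∀ j, |∑ i ∈ Finset.range (N₀ + j), d i * t i - l| ≤ K * (1 - t N₀) + ε / 3 := by
    intro j
    have h1 := hR2 j
    have h2 : |C (N₀ + j) - l| ≤ ε / 3 := by
      have := hN₀ (N₀ + j) (by omega)
      rw [Real.dist_eq] at this
      exact this.le
    have h3 : ∑ i ∈ Finset.range (N₀ + j), d i * t i - l =
        R (N₀ + j) + (C (N₀ + j) - l) * t (N₀ + j) := by simp only [hR]; ring
    have h4 : t N₀ ≤ 1 := by
      rw [← ht1]; exact antitone_nat_of_succ_le htanti (Nat.zero_le _)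
    rw [h3]
    refine (abs_add_le _ _).trans ?_
    rw [abs_mul, abs_of_nonneg (ht0 _)]
    have := mul_le_mul_of_nonneg_right h2 (ht0 (N₀ + j))
    nlinarith
  have hlim := ((hD δ hδ0).tendsto_sum_nat.comp (tendsto_add_atTop_nat N₀)).sub_const l |>.abs
  have := le_of_tendsto' hlim (fun j => by
    have := hfin j
    rw [add_comm] at this
    exact this)
  rw [Real.dist_eq]
  linarith

-- The harmonic numbers at `log₂ n` serve as a model for `∑ 1 / p`: they also grow like `log log n`,
-- their constant is known, and the associated Dirichlet series has a closed form.
open Filter Topology in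
lemma tendsto_harmonic_log_two_sub_loglog :
    Tendsto (fun n : ℕ => (harmonic (Nat.log 2 n) : ℝ) - Real.log (Real.log n)) atTop
      (𝓝 (Real.eulerMascheroniConstant - Real.log (Real.log 2))) := by
  have hlog : Tendsto (Nat.log 2) atTop atTop :=
    tendsto_atTop.2 fun b => (eventually_ge_atTop (2 ^ b)).mono fun n hn =>
      Nat.le_log_of_pow_le (by norm_num) hn
  have h1 := Real.tendsto_eulerMascheroniSeq.comp hlog
  have h2 := Real.tendsto_eulerMascheroniSeq'.comp hlog
  have hl2 : 0 < Real.log 2 := Real.log_pos (by norm_num)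
  suffices h : Tendsto (fun n : ℕ => (harmonic (Nat.log 2 n) : ℝ)
      - Real.log (Real.log n / Real.log 2)) atTop (𝓝 Real.eulerMascheroniConstant) by
    refine (h.sub_const (Real.log (Real.log 2))).congr' ?_
    filter_upwards [eventually_ge_atTop 2] with n hn
    have : 0 < Real.log n := hl2.trans_le (log_two_pos_le_log hn)
    rw [Real.log_div this.ne' hl2.ne']
    ring
  -- With `m = ⌊log₂ n⌋`, the bounds `m ≤ log n / log 2 ≤ m + 1` squeeze the expression between the
  -- two standard sequences for Euler's constant.
  refine tendsto_of_tendsto_of_tendsto_of_le_of_le' h1 h2 ?_ ?_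
  · filter_upwards [eventually_ge_atTop 2] with n hn
    have hn0 : 0 < Real.log n := hl2.trans_le (log_two_pos_le_log hn)
    simp only [Function.comp, Real.eulerMascheroniSeq]
    have : Real.log n / Real.log 2 ≤ (Nat.log 2 n : ℝ) + 1 := by
      rw [div_le_iff₀ hl2]
      have h := Nat.lt_pow_succ_log_self (by norm_num : 1 < 2) n
      have h' : (n : ℝ) ≤ 2 ^ (Nat.log 2 n + 1) := by exact_mod_cast h.le
      have := Real.log_le_log (by positivity) h'
      rw [Real.log_pow] at this
      exact_mod_cast this
    have := Real.log_le_log (by positivity) this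
    linarith
  · filter_upwards [eventually_ge_atTop 2] with n hn
    have hn0 : 0 < Real.log n := hl2.trans_le (log_two_pos_le_log hn)
    have hm : 1 ≤ Nat.log 2 n := Nat.le_log_of_pow_le (by norm_num) (by simpa using hn)
    have hm0 : (0 : ℝ) < Nat.log 2 n := by exact_mod_cast hm
    simp only [Function.comp, Real.eulerMascheroniSeq', if_neg (by omega : ¬ Nat.log 2 n = 0)]
    have : (Nat.log 2 n : ℝ) ≤ Real.log n / Real.log 2 := by
      rw [le_div_iff₀ hl2]
      have h := Nat.pow_log_le_self 2 (by omega : n ≠ 0)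
      have h' : (2 : ℝ) ^ Nat.log 2 n ≤ n := by exact_mod_cast h
      have := Real.log_le_log (by positivity) h'
      rwa [Real.log_pow] at this
    have := Real.log_le_log hm0 this
    linarith

/-- The Dirichlet series whose partial sums are `harmonic (Nat.log 2 n)`. -/
lemma hasSum_harmonic_log_two_step {δ : ℝ} (hδ : 0 < δ) :
    HasSum (fun i : ℕ => ((harmonic (Nat.log 2 (i + 1)) : ℝ) - harmonic (Nat.log 2 i)) *
      ((i : ℝ) + 1) ^ (-δ)) (-Real.log (1 - 2 ^ (-δ))) := by
  have hq : (2 : ℝ) ^ (-δ) < 1 := Real.rpow_lt_one_of_one_lt_of_neg (by norm_num) (by linarith)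
  have hq0 : (0 : ℝ) < 2 ^ (-δ) := by positivity
  -- The increment is nonzero only when `i + 1 = 2 ^ (k + 1)`, where it is `1 / (k + 1)`; the series
  -- is therefore the one for `-log (1 - q)` at `q = 2 ^ (-δ)`.
  have hinj : Function.Injective fun k : ℕ => 2 ^ (k + 1) - 1 := by
    intro a b hab
    have h1 := Nat.one_le_two_pow (n := a + 1)
    have h2 := Nat.one_le_two_pow (n := b + 1)
    have : 2 ^ (a + 1) = 2 ^ (b + 1) := by simp only at hab; omega
    have := Nat.pow_right_injective le_rfl this
    omega
  rw [← hinj.hasSum_iff]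
  · convert Real.hasSum_pow_div_log_of_abs_lt_one (x := 2 ^ (-δ)) (by rwa [abs_of_pos hq0]) using 1
    funext k
    have h1 : 1 ≤ 2 ^ (k + 1) := Nat.one_le_two_pow
    have h2 : 2 ^ (k + 1) - 1 + 1 = 2 ^ (k + 1) := by omega
    have h3 : Nat.log 2 (2 ^ (k + 1) - 1) = k := by
      rw [Nat.log_eq_iff (by
        rcases Nat.eq_zero_or_pos k with rfl | hk
        · right; norm_num
        · left; omega)]
      have : 1 ≤ 2 ^ k := Nat.one_le_two_pow
      rw [pow_succ] at h1 ⊢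
      omega
    simp only [Function.comp]
    rw [h2, h3, Nat.log_pow (by norm_num), harmonic_succ]
    have h4 : (((2 ^ (k + 1) - 1 : ℕ) : ℝ) + 1) = 2 ^ (k + 1) := by exact_mod_cast h2
    rw [h4, ← Real.rpow_natCast (2 ^ (-δ)), ← Real.rpow_mul (by norm_num),
      ← Real.rpow_natCast 2, ← Real.rpow_mul (by norm_num), mul_comm (-δ)]
    push_cast
    field_simp
    ring
  · intro i hi
    have : Nat.log 2 (i + 1) = Nat.log 2 i := by
      by_contra hne
      apply hi
      have h1 : Nat.log 2 i < Nat.log 2 (i + 1) :=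
        lt_of_le_of_ne (Nat.log_mono_right i.le_succ) (Ne.symm hne)
      obtain ⟨k, hk⟩ : ∃ k, Nat.log 2 (i + 1) = k + 1 := ⟨Nat.log 2 (i + 1) - 1, by omega⟩
      have h2 := Nat.pow_log_le_self 2 (by omega : i + 1 ≠ 0)
      have h3 := Nat.lt_pow_of_log_lt (by norm_num : 1 < 2) h1
      rw [hk] at h2 h3
      exact ⟨k, by simp only; omega⟩
    rw [this]; simp

-- The function `1 - 2 ^ (-δ)` vanishes at `0` with derivative `log 2`, so its quotient by `δ` tends
-- to `log 2`.
open Filter Topology in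
lemma tendsto_log_one_sub_two_rpow_sub_log :
    Tendsto (fun δ : ℝ => Real.log (1 - 2 ^ (-δ)) - Real.log δ) (𝓝[>] 0)
      (𝓝 (Real.log (Real.log 2))) := by
  have hd : HasDerivAt (fun δ : ℝ => (1 : ℝ) - 2 ^ (-δ)) (Real.log 2) 0 := by
    have h1 := ((hasDerivAt_neg (0 : ℝ)).const_rpow (a := 2) (by norm_num)).const_sub 1
    simpa using h1
  have h2 := hd.hasDerivWithinAt (s := Set.Ioi 0)
  rw [hasDerivWithinAt_iff_tendsto_slope' (by simp)] at h2
  have hl2 : Real.log 2 ≠ 0 := (Real.log_pos (by norm_num)).ne'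
  refine ((Real.continuousAt_log hl2).tendsto.comp h2).congr' ?_
  filter_upwards [self_mem_nhdsWithin] with δ hδ
  have hδ0 : (0 : ℝ) < δ := hδ
  have hq : (2 : ℝ) ^ (-δ) < 1 := Real.rpow_lt_one_of_one_lt_of_neg (by norm_num) (by linarith)
  simp only [Function.comp, slope_def_field]
  rw [← Real.log_div (by linarith) hδ0.ne']
  simp

/-- The second order part `log (1 + w / p) - w / p` of a factor of an Euler product. -/
noncomputable def eulerLogError (w : ℝ) (p : ℕ) : ℝ := Real.log (1 + w / p) - w / p

lemma abs_eulerLogError_le {w : ℝ} (hw : -1 ≤ w) {p : ℕ} (hp : 2 ≤ p) :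
    |eulerLogError w p| ≤ 2 * w ^ 2 / (p : ℝ) ^ 2 := by
  have hp2 : (2 : ℝ) ≤ p := by exact_mod_cast hp
  have h : -w / p ≤ 1 / 2 := by
    rw [div_le_div_iff₀ (by linarith) (by norm_num)]
    linarith
  have := abs_add_log_one_sub_le h
  rw [eulerLogError]
  convert this using 1
  · congr 1; ring_nf
  · ring

lemma summable_primes_inv_sq : Summable fun p : Nat.Primes => 1 / ((p : ℕ) : ℝ) ^ 2 := by
  refine (Nat.Primes.summable_rpow.2 (by norm_num : (-2 : ℝ) < -1)).congr fun p => ?_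
  rw [Real.rpow_neg (by positivity), one_div]
  norm_num

lemma summable_eulerLogError {w : ℝ} (hw : -1 ≤ w) :
    Summable fun p : Nat.Primes => eulerLogError w p := by
  refine Summable.of_norm_bounded (g := fun p : Nat.Primes => 2 * w ^ 2 * (1 / ((p : ℕ) : ℝ) ^ 2))
    (summable_primes_inv_sq.mul_left _) fun p => ?_
  rw [Real.norm_eq_abs, mul_one_div]
  exact abs_eulerLogError_le hw p.2.two_le

lemma Nat.Primes.rpow_neg_le_half (p : Nat.Primes) {s : ℝ} (hs : 1 ≤ s) :
    ((p : ℕ) : ℝ) ^ (-s) ≤ 1 / 2 := by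
  have hp : (2 : ℝ) ≤ (p : ℕ) := by exact_mod_cast p.2.two_le
  calc ((p : ℕ) : ℝ) ^ (-s) ≤ ((p : ℕ) : ℝ) ^ (-1 : ℝ) :=
        Real.rpow_le_rpow_of_exponent_le (by linarith) (by linarith)
    _ ≤ (2 : ℝ) ^ (-1 : ℝ) := Real.rpow_le_rpow_of_nonpos (by norm_num) hp (by norm_num)
    _ = 1 / 2 := by rw [Real.rpow_neg_one]; norm_num

lemma Nat.Primes.abs_rpow_neg_add_log_le (p : Nat.Primes) {s : ℝ} (hs : 1 ≤ s) :
    |((p : ℕ) : ℝ) ^ (-s) + Real.log (1 - ((p : ℕ) : ℝ) ^ (-s))| ≤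
      2 * (1 / ((p : ℕ) : ℝ) ^ 2) := by
  have hp : (2 : ℝ) ≤ (p : ℕ) := by exact_mod_cast p.2.two_le
  refine (abs_add_log_one_sub_le (p.rpow_neg_le_half hs)).trans ?_
  gcongr
  rw [one_div, ← inv_pow]
  gcongr
  calc ((p : ℕ) : ℝ) ^ (-s) ≤ ((p : ℕ) : ℝ) ^ (-1 : ℝ) :=
        Real.rpow_le_rpow_of_exponent_le (by linarith) (by linarith)
    _ = _ := Real.rpow_neg_one _

/-- The logarithm of the Euler product, with the prime zeta function split off; the other sum is
dominated by `∑ 2 / p ^ 2` uniformly down to `s = 1`. -/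
lemma log_riemannZeta_re_eq_tsum {s : ℝ} (hs : 1 < s) :
    Real.log (riemannZeta s).re =
      ∑' p : Nat.Primes, ((p : ℕ) : ℝ) ^ (-s) -
        ∑' p : Nat.Primes, (((p : ℕ) : ℝ) ^ (-s) + Real.log (1 - ((p : ℕ) : ℝ) ^ (-s))) := by
  have h1 : Summable fun p : Nat.Primes => ((p : ℕ) : ℝ) ^ (-s) :=
    Nat.Primes.summable_rpow.2 (by linarith)
  have h2 : Summable fun p : Nat.Primes =>
      (((p : ℕ) : ℝ) ^ (-s) + Real.log (1 - ((p : ℕ) : ℝ) ^ (-s))) :=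
    Summable.of_norm_bounded (summable_primes_inv_sq.mul_left 2) fun p =>
      p.abs_rpow_neg_add_log_le hs.le
  rw [← h1.tsum_sub h2, ← riemannZeta_eulerProduct_exp_log (by simpa using hs)]
  have h3 : ∀ p : Nat.Primes, -Complex.log (1 - ((p : ℕ) : ℂ) ^ (-(s : ℂ))) =
      ((((p : ℕ) : ℝ) ^ (-s) - (((p : ℕ) : ℝ) ^ (-s) + Real.log (1 - ((p : ℕ) : ℝ) ^ (-s))) : ℝ) : ℂ) := by
    intro p
    have := p.rpow_neg_le_half hs.le
    rw [sub_add_cancel_left, Complex.ofReal_neg, Complex.ofReal_log (by linarith),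
      Complex.ofReal_sub, Complex.ofReal_cpow (by positivity)]
    simp
  simp_rw [h3]
  rw [← Complex.ofReal_tsum, ← Complex.ofReal_exp, Complex.ofReal_re, Real.log_exp]

open Filter Topology in
lemma tendsto_tsum_rpow_neg_add_log :
    Tendsto (fun δ : ℝ => ∑' p : Nat.Primes,
        (((p : ℕ) : ℝ) ^ (-(1 + δ)) + Real.log (1 - ((p : ℕ) : ℝ) ^ (-(1 + δ))))) (𝓝[>] 0)
      (𝓝 (∑' p : Nat.Primes, eulerLogError (-1) p)) := by
  refine tendsto_tsum_of_dominated_convergence (summable_primes_inv_sq.mul_left 2) (fun p => ?_) ?_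
  · have hp : (2 : ℝ) ≤ (p : ℕ) := by exact_mod_cast p.2.two_le
    have hp0 : (0 : ℝ) < (p : ℕ) := by linarith
    have hc : ContinuousAt (fun δ : ℝ => ((p : ℕ) : ℝ) ^ (-(1 + δ)) +
        Real.log (1 - ((p : ℕ) : ℝ) ^ (-(1 + δ)))) 0 := by
      have h1 : Continuous fun δ : ℝ => ((p : ℕ) : ℝ) ^ (-(1 + δ)) :=
        (Real.continuous_const_rpow hp0.ne').comp (by fun_prop)
      refine h1.continuousAt.add (ContinuousAt.log (continuousAt_const.sub h1.continuousAt) ?_)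
      exact (sub_pos.2 ((p.rpow_neg_le_half (by norm_num)).trans_lt (by norm_num))).ne'
    have := hc.tendsto.mono_left (nhdsWithin_le_nhds (s := Set.Ioi 0))
    convert this using 2
    rw [add_zero, Real.rpow_neg_one, eulerLogError]
    ring_nf
  · filter_upwards [self_mem_nhdsWithin] with δ hδ p
    have hδ0 : (0 : ℝ) < δ := hδ
    exact p.abs_rpow_neg_add_log_le (by linarith)

open Filter Topology in
lemma tendsto_log_riemannZeta_add_log :
    Tendsto (fun δ : ℝ => Real.log (riemannZeta ((1 + δ : ℝ) : ℂ)).re + Real.log δ) (𝓝[>] 0)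
      (𝓝 0) := by
  have h := log_riemannZeta_add_log_sub_isLittleO_ofReal
  rw [Asymptotics.isLittleO_one_iff] at h
  have h2 : Tendsto (fun δ : ℝ => 1 + δ) (𝓝[>] 0) (𝓝[>] 1) := by
    refine tendsto_nhdsWithin_iff.2 ⟨?_, ?_⟩
    · have : Continuous fun δ : ℝ => 1 + δ := by fun_prop
      simpa using (this.tendsto 0).mono_left (nhdsWithin_le_nhds (s := Set.Ioi 0))
    · filter_upwards [self_mem_nhdsWithin] with δ hδ
      have hδ0 : (0 : ℝ) < δ := hδ
      simpa using hδ0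
  refine (h.comp h2).congr fun δ => ?_
  simp

lemma hasSum_prime_rpow {δ : ℝ} (hδ : 0 < δ) :
    HasSum (fun i : ℕ => (if (i + 1).Prime then (1 : ℝ) / ((i + 1 : ℕ) : ℝ) else 0) *
      ((i : ℝ) + 1) ^ (-δ)) (∑' p : Nat.Primes, ((p : ℕ) : ℝ) ^ (-(1 + δ))) := by
  have hinj : Function.Injective fun p : Nat.Primes => (p : ℕ) - 1 := by
    intro a b hab
    have h1 := a.2.one_le
    have h2 := b.2.one_le
    apply Subtype.ext
    simp only at hab
    omega
  rw [← hinj.hasSum_iff]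
  · convert (Nat.Primes.summable_rpow.2 (by linarith : -(1 + δ) < -1)).hasSum using 1
    funext p
    have h1 : (p : ℕ) - 1 + 1 = p := Nat.sub_add_cancel p.2.one_le
    have h2 : (((p : ℕ) - 1 : ℕ) : ℝ) + 1 = (p : ℕ) := by exact_mod_cast h1
    have hp : (0 : ℝ) < (p : ℕ) := by exact_mod_cast p.2.pos
    simp only [Function.comp]
    rw [h1, h2, if_pos p.2, neg_add, Real.rpow_add hp, Real.rpow_neg_one, one_div]
  · intro i hi
    rw [if_neg, zero_mul]
    intro hp
    exact hi ⟨⟨i + 1, hp⟩, by simp⟩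

open Filter Topology in
/-- The constant in Mertens' second theorem. -/
theorem mertens_constant_eq {M K : ℝ}
    (hM : ∀ n : ℕ, 2 ≤ n →
      |∑ p ∈ n.primesLE, (1 : ℝ) / p - Real.log (Real.log n) - M| ≤ K / Real.log n) :
    M = Real.eulerMascheroniConstant + ∑' p : Nat.Primes, eulerLogError (-1) p := by
  set d : ℕ → ℝ := fun i => (if (i + 1).Prime then (1 : ℝ) / ((i + 1 : ℕ) : ℝ) else 0) -
    ((harmonic (Nat.log 2 (i + 1)) : ℝ) - harmonic (Nat.log 2 i)) with hd
  have hsum : ∀ N, ∑ i ∈ Finset.range N, d i =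
      ∑ p ∈ N.primesLE, (1 : ℝ) / p - harmonic (Nat.log 2 N) := by
    intro N
    rw [hd, Finset.sum_sub_distrib, Finset.sum_range_sub (fun i => (harmonic (Nat.log 2 i) : ℝ))]
    simp only [Nat.log_zero_right, harmonic_zero, Rat.cast_zero, sub_zero, sub_left_inj]
    induction N with
    | zero => simp
    | succ N ih => rw [Finset.sum_range_succ, ih, sum_primesLE_succ (fun p => (1 : ℝ) / p)]
  have hS : Tendsto (fun n : ℕ => ∑ p ∈ n.primesLE, (1 : ℝ) / p - Real.log (Real.log n)) atTop
      (𝓝 M) := by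
    rw [tendsto_iff_dist_tendsto_zero]
    have h0 : Tendsto (fun n : ℕ => K / Real.log n) atTop (𝓝 0) :=
      (Real.tendsto_log_atTop.comp tendsto_natCast_atTop_atTop).const_div_atTop K
    refine squeeze_zero' (Eventually.of_forall fun _ => dist_nonneg) ?_ h0
    filter_upwards [eventually_ge_atTop 2] with n hn
    exact hM n hn
  have hlim : Tendsto (fun N => ∑ i ∈ Finset.range N, d i) atTop
      (𝓝 (M - (Real.eulerMascheroniConstant - Real.log (Real.log 2)))) := by
    refine (hS.sub tendsto_harmonic_log_two_sub_loglog).congr fun N => ?_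
    rw [hsum]; ring
  have hD := tendsto_dirichletSeries_of_tendsto_sum hlim
    (D := fun δ => ∑' p : Nat.Primes, ((p : ℕ) : ℝ) ^ (-(1 + δ)) - -Real.log (1 - 2 ^ (-δ)))
    fun δ hδ => ((hasSum_prime_rpow hδ).sub (hasSum_harmonic_log_two_step hδ)).congr_fun
      fun i => by rw [hd]; ring
  -- The same limit computed a second way: the singularities `log δ` of `log ζ(1 + δ)` and of the
  -- model series cancel. Comparing the two values determines `M`, and `log log 2` drops out.
  have hD' := (tendsto_log_riemannZeta_add_log.add tendsto_tsum_rpow_neg_add_log).add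
    tendsto_log_one_sub_two_rpow_sub_log
  have := tendsto_nhds_unique hD (hD'.congr' ?_)
  · linarith
  · filter_upwards [self_mem_nhdsWithin] with δ hδ
    have hδ0 : (0 : ℝ) < δ := hδ
    rw [log_riemannZeta_re_eq_tsum (by linarith)]
    ring

/-! ### Mertens' estimates over the primes below a real `y` -/

/-- The primes `p < y`. -/
noncomputable def primesLT (y : ℝ) : Finset ℕ := Nat.primesBelow ⌈y⌉₊

lemma mem_primesLT {y : ℝ} {p : ℕ} : p ∈ primesLT y ↔ (p : ℝ) < y ∧ p.Prime := by
  rw [primesLT, Nat.mem_primesBelow, Nat.lt_ceil]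

/-- The constant in Mertens' second theorem. -/
noncomputable def mertensConst : ℝ :=
  Real.eulerMascheroniConstant + ∑' p : Nat.Primes, eulerLogError (-1) p

lemma exists_nat_primesLT_eq {y : ℝ} (hy : Real.exp 1 ≤ y) :
    ∃ n : ℕ, 2 ≤ n ∧ primesLT y = n.primesLE ∧ (n : ℝ) ≤ y ∧ y ≤ n + 1 := by
  have he : (2 : ℝ) < Real.exp 1 := by linarith [Real.exp_one_gt_d9]
  have h2 : 2 < ⌈y⌉₊ := Nat.lt_ceil.2 (by push_cast; linarith)
  refine ⟨⌈y⌉₊ - 1, by omega, Nat.primesBelow_eq_primesLE_sub_one _, ?_, ?_⟩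
  · exact (Nat.lt_ceil.1 (by omega : ⌈y⌉₊ - 1 < ⌈y⌉₊)).le
  · have : ((⌈y⌉₊ - 1 : ℕ) : ℝ) + 1 = ⌈y⌉₊ := by exact_mod_cast (by omega)
    rw [this]
    exact Nat.le_ceil y

lemma one_le_log_of_exp_one_le {y : ℝ} (hy : Real.exp 1 ≤ y) : 1 ≤ Real.log y := by
  rwa [Real.le_log_iff_exp_le ((Real.exp_pos 1).trans_le hy)]

/-- Mertens' second theorem. -/
theorem exists_abs_sum_primesLT_inv_sub_le :
    ∃ K : ℝ, 0 < K ∧ ∀ y : ℝ, Real.exp 1 ≤ y →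
      |∑ p ∈ primesLT y, (1 : ℝ) / p - Real.log (Real.log y) - mertensConst| ≤
        K / Real.log y := by
  obtain ⟨M, K, hK0, hK⟩ := exists_abs_sum_inv_sub_loglog_sub_le
  obtain rfl : M = mertensConst := mertens_constant_eq hK
  refine ⟨2 * (K + 1), by linarith, fun y hy => ?_⟩
  obtain ⟨n, hn, hP, hny, hyn⟩ := exists_nat_primesLT_eq hy
  have hn2 : (2 : ℝ) ≤ n := by exact_mod_cast hn
  have hl0 : 0 < Real.log n := (Real.log_pos (by norm_num)).trans_le (log_two_pos_le_log hn)
  have hly : Real.log n ≤ Real.log y := Real.log_le_log (by linarith) hny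
  have hyl : Real.log y - Real.log n ≤ 1 := by
    have h1 := log_succ_sub_log_le (n := n) (by omega)
    have h2 : Real.log y ≤ Real.log (n + 1 : ℕ) :=
      Real.log_le_log (by linarith) (by push_cast; exact hyn)
    have h3 : (1 : ℝ) / n ≤ 1 := by rw [div_le_one (by linarith)]; linarith
    linarith
  have hy2 : Real.log y ≤ 2 * Real.log n := by
    rw [two_mul, ← Real.log_mul (by linarith) (by linarith)]
    exact Real.log_le_log (by linarith) (by nlinarith)
  have hll0 : Real.log (Real.log n) ≤ Real.log (Real.log y) := Real.log_le_log hl0 hly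
  have hll1 : Real.log (Real.log y) - Real.log (Real.log n) ≤ 1 / Real.log n := by
    rw [← Real.log_div (by linarith) hl0.ne']
    refine (Real.log_le_sub_one_of_pos (div_pos (by linarith) hl0)).trans ?_
    rw [div_sub_one hl0.ne']
    gcongr
  have h := hK n hn
  rw [hP]
  have hfin : (K + 1) / Real.log n ≤ 2 * (K + 1) / Real.log y := by
    rw [div_le_div_iff₀ hl0 (by linarith)]
    nlinarith
  have hsplit : (K + 1) / Real.log n = K / Real.log n + 1 / Real.log n := by ring
  rw [abs_le] at h ⊢
  constructor <;> linarith [h.1, h.2]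

lemma exists_sum_primesLT_log_div_le :
    ∃ B : ℝ, 0 < B ∧ ∀ y : ℝ, Real.exp 1 ≤ y →
      ∑ p ∈ primesLT y, Real.log p / p ≤ B * Real.log y := by
  obtain ⟨B, hB0, hB⟩ := exists_abs_sum_log_div_sub_log_le
  refine ⟨B + 1, by linarith, fun y hy => ?_⟩
  obtain ⟨n, hn, hP, hny, -⟩ := exists_nat_primesLT_eq hy
  have hl1 := one_le_log_of_exp_one_le hy
  have hly : Real.log n ≤ Real.log y :=
    Real.log_le_log (by exact_mod_cast (by omega)) hny
  rw [hP]
  have := (abs_le.1 (hB n (by omega))).2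
  nlinarith

lemma sum_primesLT_eq_tsum (f : ℕ → ℝ) (y : ℝ) :
    ∑ p ∈ primesLT y, f p = ∑' p : Nat.Primes, if ((p : ℕ) : ℝ) < y then f p else 0 := by
  have h := tsum_subtype {n : ℕ | n.Prime} (fun p => if (p : ℝ) < y then f p else 0)
  refine Eq.trans ?_ h.symm
  rw [tsum_eq_sum (s := primesLT y)]
  · refine Finset.sum_congr rfl fun p hp => ?_
    rw [mem_primesLT] at hp
    rw [Set.indicator_of_mem (by exact hp.2), if_pos hp.1]
  · intro p hp
    rw [mem_primesLT] at hp
    by_cases hpp : p.Prime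
    · rw [Set.indicator_of_mem (by exact hpp), if_neg (fun h => hp ⟨h, hpp⟩)]
    · rw [Set.indicator_of_notMem (by exact hpp)]

/-- For `p ≥ y` one has `log y ≤ 2 √p`, so a factor `1 / log y` can be taken out of the tail of `∑ 1
/ p ^ 2` while `∑ √p / p ^ 2` still converges. -/
lemma exists_abs_tsum_eulerLogError_sub_sum_le :
    ∃ K : ℝ, 0 < K ∧ ∀ y w : ℝ, Real.exp 1 ≤ y → -1 ≤ w →
      |∑' p : Nat.Primes, eulerLogError w p - ∑ p ∈ primesLT y, eulerLogError w p| ≤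
        K * w ^ 2 / Real.log y := by
  have hsum : Summable fun p : Nat.Primes => Real.sqrt (p : ℕ) / ((p : ℕ) : ℝ) ^ 2 :=
    summable_sqrt_div_sq.comp_injective Subtype.val_injective
  set T := ∑' p : Nat.Primes, Real.sqrt (p : ℕ) / ((p : ℕ) : ℝ) ^ 2 with hT
  have hT0 : 0 ≤ T := tsum_nonneg fun _ => by positivity
  refine ⟨4 * T + 1, by positivity, fun y w hy hw => ?_⟩
  have hl1 := one_le_log_of_exp_one_le hy
  have hs := summable_eulerLogError hw
  have hs' : Summable fun p : Nat.Primes =>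
      if ((p : ℕ) : ℝ) < y then eulerLogError w p else 0 :=
    Summable.of_norm_bounded hs.norm fun p => by
      split_ifs
      · exact le_rfl
      · simp
  rw [sum_primesLT_eq_tsum, ← hs.tsum_sub hs']
  have hb := tsum_of_norm_bounded (f := fun p : Nat.Primes => eulerLogError w p -
    if ((p : ℕ) : ℝ) < y then eulerLogError w p else 0)
    ((hsum.hasSum).mul_left (4 * w ^ 2 / Real.log y)) fun p => by
      split_ifs with hp
      · rw [sub_self, norm_zero]; positivity
      · rw [sub_zero, Real.norm_eq_abs]
        have hp0 : (0 : ℝ) < (p : ℕ) := by exact_mod_cast p.2.pos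
        refine (abs_eulerLogError_le hw p.2.two_le).trans ?_
        have h1 : Real.log y ≤ 2 * Real.sqrt (p : ℕ) :=
          (Real.log_le_log ((Real.exp_pos 1).trans_le hy) (not_lt.1 hp)).trans
            (log_nat_le_two_mul_sqrt p)
        rw [div_mul_div_comm, div_le_div_iff₀ (by positivity) (by positivity)]
        calc 2 * w ^ 2 * (Real.log y * ((p : ℕ) : ℝ) ^ 2)
            ≤ 2 * w ^ 2 * ((2 * Real.sqrt (p : ℕ)) * ((p : ℕ) : ℝ) ^ 2) := by gcongr
          _ = _ := by ring
  rw [Real.norm_eq_abs] at hb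
  refine hb.trans ?_
  rw [← hT, div_mul_eq_mul_div]
  refine div_le_div_of_nonneg_right ?_ (by linarith)
  nlinarith [sq_nonneg w]

/-! ### Inclusion–exclusion and Rankin's trick -/

open Polynomial in
/-- The generating polynomial of the density of the integers with a given number of prime factors
below `y`. -/
noncomputable def densityPoly (y : ℝ) : ℝ[X] :=
  ∏ p ∈ primesLT y, (1 + (X - 1) * C (1 / (p : ℝ)))

open Polynomial in
lemma densityPoly_eq_sum (y : ℝ) :
    densityPoly y = ∑ T ∈ (primesLT y).powerset,
      (X - 1) ^ T.card * C (1 / ((∏ p ∈ T, p : ℕ) : ℝ)) := by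
  rw [densityPoly, Finset.prod_one_add]
  refine Finset.sum_congr rfl fun T _ => ?_
  rw [Finset.prod_mul_distrib, Finset.prod_const, ← map_prod]
  congr 2
  simp

lemma prod_dvd_iff_of_subset_primesLT {y : ℝ} {T : Finset ℕ} (hT : T ⊆ primesLT y) (n : ℕ) :
    ∏ p ∈ T, p ∣ n ↔ ∀ p ∈ T, p ∣ n := by
  refine ⟨fun h p hp => (Finset.dvd_prod_of_mem _ hp).trans h, fun h => ?_⟩
  exact Finset.prod_primes_dvd n (fun p hp => (mem_primesLT.1 (hT hp)).2.prime) h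

-- Each prime below `y` dividing `n` contributes `X = 1 + (X - 1)`; the product is expanded over
-- subsets of these primes.
open Polynomial in
lemma X_pow_omegaBelow {y : ℝ} {n : ℕ} (hn : n ≠ 0) :
    (X : ℝ[X]) ^ omegaBelow y n = ∑ T ∈ (primesLT y).powerset,
      if ∏ p ∈ T, p ∣ n then (X - 1) ^ T.card else 0 := by
  have h1 : n.primeFactors.filter (fun p : ℕ => (p : ℝ) < y) =
      (primesLT y).filter (fun p => p ∣ n) := by
    ext p
    simp only [Finset.mem_filter, Nat.mem_primeFactors, mem_primesLT]
    tauto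
  rw [omegaBelow, h1, ← Finset.prod_const,
    Finset.prod_congr rfl fun _ _ => show (X : ℝ[X]) = 1 + (X - 1) by ring,
    Finset.prod_one_add, ← Finset.sum_filter]
  simp only [Finset.prod_const]
  refine Finset.sum_congr ?_ fun _ _ => rfl
  ext T
  simp only [Finset.mem_powerset, Finset.mem_filter, Finset.subset_iff]
  constructor
  · intro h
    have hT : T ⊆ primesLT y := fun p hp => (h hp).1
    exact ⟨fun p hp => (h hp).1, (prod_dvd_iff_of_subset_primesLT hT n).2 fun p hp => (h hp).2⟩
  · rintro ⟨h, hd⟩ p hp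
    exact ⟨h hp, (prod_dvd_iff_of_subset_primesLT h n).1 hd p hp⟩

open Polynomial in
lemma countBelow_eq_sum (k : ℕ) (x y : ℝ) :
    (countBelow k x y : ℝ) = ∑ T ∈ (primesLT y).powerset,
      ((X - 1 : ℝ[X]) ^ T.card).coeff k * ⌊x / ((∏ p ∈ T, p : ℕ) : ℝ)⌋₊ := by
  have h1 : (countBelow k x y : ℝ) =
      ∑ n ∈ Finset.Icc 1 ⌊x⌋₊, ((X : ℝ[X]) ^ omegaBelow y n).coeff k := by
    rw [countBelow, Finset.card_filter]
    push_cast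
    refine Finset.sum_congr rfl fun n _ => ?_
    rw [coeff_X_pow]
    simp only [eq_comm]
  rw [h1]
  have h2 : ∀ n ∈ Finset.Icc 1 ⌊x⌋₊, ((X : ℝ[X]) ^ omegaBelow y n).coeff k =
      ∑ T ∈ (primesLT y).powerset,
        if ∏ p ∈ T, p ∣ n then ((X - 1 : ℝ[X]) ^ T.card).coeff k else 0 := by
    intro n hn
    rw [X_pow_omegaBelow (by have := (Finset.mem_Icc.1 hn).1; omega), finsetSum_coeff]
    refine Finset.sum_congr rfl fun T _ => ?_
    split_ifs <;> simp
  rw [Finset.sum_congr rfl h2, Finset.sum_comm]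
  refine Finset.sum_congr rfl fun T _ => ?_
  rw [← Finset.sum_filter, Finset.sum_const, nsmul_eq_mul, mul_comm, Nat.floor_div_natCast,
    ← Nat.Ioc_filter_dvd_card_eq_div]
  rfl

-- The left side is a single term of the binomial expansion of `(1 + ρ) ^ m`. The weight `ρ ^ k` is
-- kept because at `ρ = k / log log y` it compensates for `(log log y) ^ k / k!`.
open Polynomial in
lemma abs_coeff_X_sub_one_pow_mul_le (m k : ℕ) {ρ : ℝ} (hρ : 0 ≤ ρ) :
    |((X - 1 : ℝ[X]) ^ m).coeff k| * ρ ^ k ≤ (1 + ρ) ^ m := by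
  have h : (X - 1 : ℝ[X]) = X + C (-1) := by simp [sub_eq_add_neg]
  rw [h, coeff_X_add_C_pow, abs_mul, abs_pow, abs_neg, abs_one, one_pow, one_mul, Nat.abs_cast]
  rcases le_or_gt k m with hk | hk
  · rw [add_comm, add_pow]
    refine le_trans (le_of_eq ?_) (Finset.single_le_sum
      (f := fun i => ρ ^ i * 1 ^ (m - i) * (m.choose i : ℝ))
      (fun i _ => by positivity) (Finset.mem_range.2 (by omega : k < m + 1)))
    simp only [one_pow, mul_one]
    ring
  · rw [Nat.choose_eq_zero_of_lt hk]
    simp only [Nat.cast_zero, zero_mul]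
    positivity

/-- The fractional error is at most `min(1, t)`, and `t ^ σ` interpolates between these two bounds.
This makes the error multiplicative in the divisor. -/
lemma abs_floor_sub_le_rpow {t σ : ℝ} (ht : 0 < t) (h0 : 0 ≤ σ) (h1 : σ ≤ 1) :
    |(⌊t⌋₊ : ℝ) - t| ≤ t ^ σ := by
  have hf := Nat.floor_le ht.le
  have hf' := Nat.lt_floor_add_one t
  rw [abs_sub_comm, abs_of_nonneg (by linarith)]
  rcases le_or_gt 1 t with h | h
  · have := Real.one_le_rpow h h0
    linarith
  · rw [Nat.floor_eq_zero.2 h]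
    have := Real.rpow_le_rpow_of_exponent_ge ht h.le h1
    simpa using this

/-- Comparison of `countBelow` with the density predicted by `densityPoly`, by Rankin's trick. -/
theorem abs_countBelow_sub_mul_pow_le (k : ℕ) {x y σ ρ : ℝ} (hx : 0 < x) (h0 : 0 ≤ σ) (h1 : σ ≤ 1)
    (hρ : 0 ≤ ρ) :
    |(countBelow k x y : ℝ) - x * (densityPoly y).coeff k| * ρ ^ k ≤
      x ^ σ * ∏ p ∈ primesLT y, (1 + (1 + ρ) * ((p : ℝ) ^ σ)⁻¹) := by
  have h2 : (countBelow k x y : ℝ) - x * (densityPoly y).coeff k =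
      ∑ T ∈ (primesLT y).powerset, ((Polynomial.X - 1 : Polynomial ℝ) ^ T.card).coeff k *
        (⌊x / ((∏ p ∈ T, p : ℕ) : ℝ)⌋₊ - x / ((∏ p ∈ T, p : ℕ) : ℝ)) := by
    rw [countBelow_eq_sum, densityPoly_eq_sum, Polynomial.finsetSum_coeff, Finset.mul_sum,
      ← Finset.sum_sub_distrib]
    refine Finset.sum_congr rfl fun T _ => ?_
    rw [Polynomial.coeff_mul_C]
    ring
  rw [h2, Finset.prod_one_add, Finset.mul_sum]
  refine (mul_le_mul_of_nonneg_right (Finset.abs_sum_le_sum_abs _ _) (pow_nonneg hρ k)).trans ?_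
  rw [Finset.sum_mul]
  refine Finset.sum_le_sum fun T hT => ?_
  have hpos : (0 : ℝ) < (∏ p ∈ T, p : ℕ) := by
    exact_mod_cast Finset.prod_pos fun p hp =>
      (mem_primesLT.1 (Finset.mem_powerset.1 hT hp)).2.pos
  rw [abs_mul, Finset.prod_mul_distrib, Finset.prod_const]
  calc |((Polynomial.X - 1 : Polynomial ℝ) ^ T.card).coeff k| *
        |(⌊x / ((∏ p ∈ T, p : ℕ) : ℝ)⌋₊ : ℝ) - x / ((∏ p ∈ T, p : ℕ) : ℝ)| * ρ ^ k
      = (|((Polynomial.X - 1 : Polynomial ℝ) ^ T.card).coeff k| * ρ ^ k) *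
        |(⌊x / ((∏ p ∈ T, p : ℕ) : ℝ)⌋₊ : ℝ) - x / ((∏ p ∈ T, p : ℕ) : ℝ)| := by ring
    _ ≤ (1 + ρ) ^ T.card * (x / ((∏ p ∈ T, p : ℕ) : ℝ)) ^ σ := by
        gcongr
        · exact abs_coeff_X_sub_one_pow_mul_le _ _ hρ
        · exact abs_floor_sub_le_rpow (div_pos hx hpos) h0 h1
    _ = _ := by
        rw [Real.div_rpow hx.le hpos.le, Nat.cast_prod,
          ← Real.finsetProd_rpow _ _ (fun p _ => Nat.cast_nonneg p), Finset.prod_inv_distrib]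
        ring

lemma prod_one_add_mul_le_exp (s : Finset ℕ) {A : ℝ} (hA : 0 ≤ A) {f : ℕ → ℝ}
    (hf : ∀ p ∈ s, 0 ≤ f p) :
    ∏ p ∈ s, (1 + A * f p) ≤ Real.exp (A * ∑ p ∈ s, f p) := by
  rw [Finset.mul_sum, Real.exp_sum]
  refine Finset.prod_le_prod (fun p hp => ?_) fun p _ => ?_
  · have := mul_nonneg hA (hf p hp); linarith
  · linarith [Real.add_one_le_exp (A * f p)]

/-- Here `p ^ (c / log y) = e ^ u` with `0 ≤ u ≤ c`, and `e ^ u ≤ 1 + u e ^ c`. By Mertens' first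
theorem the extra term sums to `O(1)` over `p < y`. -/
lemma inv_rpow_one_sub_le {p : ℕ} (hp : p.Prime) {y c : ℝ} (hpy : (p : ℝ) < y) (hc : 0 ≤ c) :
    ((p : ℝ) ^ (1 - c / Real.log y))⁻¹ ≤
      1 / p + c * Real.exp c / Real.log y * (Real.log p / p) := by
  have hp1 : (1 : ℝ) < p := by exact_mod_cast hp.one_lt
  have hp0 : (0 : ℝ) < p := by linarith
  have hlp : 0 < Real.log p := Real.log_pos hp1
  have hly : 0 < Real.log y := Real.log_pos (hp1.trans hpy)
  have hle : Real.log p ≤ Real.log y := Real.log_le_log hp0 hpy.le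
  set u := c / Real.log y * Real.log p with hu
  have hu0 : 0 ≤ u := by positivity
  have huc : u ≤ c := by
    rw [hu, div_mul_eq_mul_div, div_le_iff₀ hly]; gcongr
  have hexp : Real.exp u ≤ 1 + u * Real.exp c := by
    have h1 := Real.add_one_le_exp (-u)
    have h2 : (-u + 1) * Real.exp u ≤ 1 := by
      calc (-u + 1) * Real.exp u ≤ Real.exp (-u) * Real.exp u := by gcongr
        _ = 1 := by rw [← Real.exp_add]; simp
    have h3 : u * Real.exp u ≤ u * Real.exp c := by gcongr
    linarith
  rw [← Real.rpow_neg hp0.le, neg_sub, Real.rpow_sub hp0, Real.rpow_one,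
    Real.rpow_def_of_pos hp0, mul_comm (Real.log p), ← hu]
  calc Real.exp u / p ≤ (1 + u * Real.exp c) / p := by gcongr
    _ = _ := by rw [hu]; ring

/-- The error term of `abs_countBelow_sub_mul_pow_le` when `log x / log y` exceeds
`log (log x)`. -/
theorem exists_abs_countBelow_sub_le (r : ℝ) (hr : 0 < r) :
    ∃ K : ℝ, 0 < K ∧ ∀ (x y ρ : ℝ) (k : ℕ), Real.exp 1 ≤ y → y ≤ x →
      0 < Real.log (Real.log y) → Real.log (Real.log x) < Real.log x / Real.log y →
      0 ≤ ρ → ρ ≤ r →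
      |(countBelow k x y : ℝ) - x * (densityPoly y).coeff k| * ρ ^ k *
        (Real.log y * Real.log (Real.log y) ^ 2) ≤ K * x := by
  obtain ⟨K₁, hK₁, hS⟩ := exists_abs_sum_primesLT_inv_sub_le
  obtain ⟨B, hB0, hB⟩ := exists_sum_primesLT_log_div_le
  set A : ℝ := 1 + r with hA
  have hA0 : 0 < A := by linarith
  -- The Euler product costs `(log y) ^ A` and the target factor `log y (log log y) ^ 2` at most
  -- `(log y) ^ 3`; the saving `(log y) ^ (-c)` must absorb both.
  set c : ℝ := A + 3 with hc
  have hc0 : 0 < c := by linarith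
  set S₀ : ℝ := |mertensConst| + K₁ with hS₀
  set K₂ : ℝ := Real.exp (A * (S₀ + c * Real.exp c * B)) with hK₂
  set K₃ : ℝ := Real.exp (A * (c + S₀)) * c ^ 3 with hK₃
  have hK₂0 : 0 < K₂ := Real.exp_pos _
  have hK₃0 : 0 < K₃ := by positivity
  refine ⟨K₂ + K₃, by positivity, fun x y ρ k hy hyx hL hα hρ hρr => ?_⟩
  have hy0 : 0 < y := (Real.exp_pos 1).trans_le hy
  have hx0 : 0 < x := hy0.trans_le hyx
  have hl1 := one_le_log_of_exp_one_le hy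
  have hl0 : 0 < Real.log y := by linarith
  have hLl : Real.log (Real.log y) ≤ Real.log y := Real.log_le_self hl0.le
  have hsum : ∑ p ∈ primesLT y, (1 : ℝ) / p ≤ Real.log (Real.log y) + S₀ := by
    have h1 := (abs_le.1 (hS y hy)).2
    have h2 : K₁ / Real.log y ≤ K₁ := div_le_self hK₁.le hl1
    linarith [le_abs_self mertensConst]
  have hgen : ∀ σ : ℝ, 0 ≤ σ → σ ≤ 1 →
      |(countBelow k x y : ℝ) - x * (densityPoly y).coeff k| * ρ ^ k ≤
        x ^ σ * Real.exp (A * ∑ p ∈ primesLT y, ((p : ℝ) ^ σ)⁻¹) := by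
    intro σ h0 h1
    refine (abs_countBelow_sub_mul_pow_le k hx0 h0 h1 hρ).trans ?_
    gcongr
    refine (prod_one_add_mul_le_exp _ (by linarith) fun p _ => by positivity).trans ?_
    gcongr
    linarith
  rcases le_or_gt c (Real.log y) with hcy | hcy
  · have hσ0 : 0 ≤ 1 - c / Real.log y := by
      rw [sub_nonneg, div_le_one hl0]; exact hcy
    have hσ1 : 1 - c / Real.log y ≤ 1 := by
      have : 0 ≤ c / Real.log y := by positivity
      linarith
    have h1 := hgen _ hσ0 hσ1
    have h2 : ∑ p ∈ primesLT y, ((p : ℝ) ^ (1 - c / Real.log y))⁻¹ ≤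
        Real.log (Real.log y) + (S₀ + c * Real.exp c * B) := by
      calc ∑ p ∈ primesLT y, ((p : ℝ) ^ (1 - c / Real.log y))⁻¹
          ≤ ∑ p ∈ primesLT y, ((1 : ℝ) / p + c * Real.exp c / Real.log y * (Real.log p / p)) :=
            Finset.sum_le_sum fun p hp =>
              inv_rpow_one_sub_le (mem_primesLT.1 hp).2 (mem_primesLT.1 hp).1 hc0.le
        _ = ∑ p ∈ primesLT y, (1 : ℝ) / p +
            c * Real.exp c / Real.log y * ∑ p ∈ primesLT y, Real.log p / p := by
            rw [Finset.sum_add_distrib, Finset.mul_sum]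
        _ ≤ (Real.log (Real.log y) + S₀) + c * Real.exp c / Real.log y * (B * Real.log y) := by
            gcongr
            exact hB y hy
        _ = _ := by field_simp; ring
    have h3 : x ^ (1 - c / Real.log y) ≤ x * Real.exp (-(c * Real.log (Real.log y))) := by
      rw [Real.rpow_sub hx0, Real.rpow_one, Real.exp_neg, ← div_eq_mul_inv]
      gcongr
      rw [Real.rpow_def_of_pos hx0, Real.exp_le_exp]
      have h4 : Real.log (Real.log y) ≤ Real.log (Real.log x) :=
        Real.log_le_log hl0 (Real.log_le_log hy0 hyx)
      calc c * Real.log (Real.log y) ≤ c * (Real.log x / Real.log y) := by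
            gcongr; linarith
        _ = _ := by ring
    have h5 : Real.log (Real.log y) ^ 2 ≤ Real.exp (2 * Real.log (Real.log y)) := by
      rw [two_mul, Real.exp_add, sq]
      have := Real.add_one_le_exp (Real.log (Real.log y))
      gcongr <;> linarith
    calc |(countBelow k x y : ℝ) - x * (densityPoly y).coeff k| * ρ ^ k *
          (Real.log y * Real.log (Real.log y) ^ 2)
        ≤ (x * Real.exp (-(c * Real.log (Real.log y))) *
            Real.exp (A * (Real.log (Real.log y) + (S₀ + c * Real.exp c * B)))) *
            (Real.exp (Real.log (Real.log y)) * Real.exp (2 * Real.log (Real.log y))) := by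
          refine mul_le_mul (h1.trans ?_) ?_ (by positivity) (by positivity)
          · gcongr
          · rw [Real.exp_log hl0]; gcongr
      _ = K₂ * x := by
          rw [hK₂, mul_assoc, mul_assoc, ← Real.exp_add, ← Real.exp_add, ← Real.exp_add, mul_comm x]
          congr 2
          rw [hc]; ring
      _ ≤ (K₂ + K₃) * x := by gcongr; linarith
  -- For `log y < c` the exponent `1 - c / log y` would be negative, but every quantity depending on
  -- `y` is then bounded and `σ = 1` suffices.
  · have h1 := hgen 1 zero_le_one le_rfl
    simp only [Real.rpow_one, ← one_div] at h1
    calc |(countBelow k x y : ℝ) - x * (densityPoly y).coeff k| * ρ ^ k *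
          (Real.log y * Real.log (Real.log y) ^ 2)
        ≤ (x * Real.exp (A * (c + S₀))) * (c * c ^ 2) := by
          refine mul_le_mul (h1.trans ?_) ?_ (by positivity) (by positivity)
          · gcongr
            linarith
          · gcongr
            linarith
      _ = K₃ * x := by rw [hK₃]; ring
      _ ≤ (K₂ + K₃) * x := by gcongr; linarith

/-! ### Coefficient asymptotics from Taylor coefficients -/

lemma iteratedDeriv_polynomial_eval_zero (p : Polynomial ℂ) (k : ℕ) :
    iteratedDeriv k (fun z => p.eval z) 0 = k.factorial * p.coeff k := by
  have h : ∀ n : ℕ, iteratedDeriv n (fun z => p.eval z) =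
      fun z => (Polynomial.derivative^[n] p).eval z := by
    intro n
    induction n with
    | zero => simp
    | succ n ih =>
      rw [iteratedDeriv_succ, ih, Function.iterate_succ_apply']
      funext z
      exact Polynomial.deriv _
  rw [h]
  simp only
  rw [← Polynomial.coeff_zero_eq_eval_zero, Polynomial.coeff_iterate_derivative, zero_add,
    Nat.descFactorial_self, nsmul_eq_mul]

lemma iteratedDeriv_exp_mul_zero (a : ℂ) (k : ℕ) :
    iteratedDeriv k (fun z => Complex.exp (z * a)) 0 = a ^ k := by
  have h : ∀ n : ℕ, iteratedDeriv n (fun z => Complex.exp (z * a)) =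
      fun z => a ^ n * Complex.exp (z * a) := by
    intro n
    induction n with
    | zero => simp
    | succ n ih =>
      rw [iteratedDeriv_succ, ih]
      funext z
      have h1 : HasDerivAt (fun z => Complex.exp (z * a)) (Complex.exp (z * a) * a) z := by
        simpa using ((hasDerivAt_id z).mul_const a).cexp
      rw [(h1.const_mul (a ^ n)).deriv]
      ring
  rw [h]
  simp

/-- The `k`-th coefficient of `p` in terms of the Taylor coefficients of `p z * exp (-z * L)`. -/
lemma coeff_eq_sum_iteratedDeriv (p : Polynomial ℂ) {L : ℝ} (hL : 0 < L) (k : ℕ) :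
    p.coeff k = (L ^ k / k.factorial : ℝ) * ∑ j ∈ Finset.range (k + 1),
      (j.factorial : ℂ)⁻¹ * iteratedDeriv j (fun z => p.eval z * Complex.exp (-(z * L))) 0 *
        (k.descFactorial j / L ^ j : ℝ) := by
  have hL' : (L : ℂ) ≠ 0 := by exact_mod_cast hL.ne'
  have hk : (k.factorial : ℂ) ≠ 0 := by exact_mod_cast k.factorial_ne_zero
  set F : ℂ → ℂ := fun z => p.eval z * Complex.exp (-(z * L)) with hF
  have hd : Differentiable ℂ F := by
    have := p.differentiable
    fun_prop
  have h1 : (fun z => p.eval z) = fun z => F z * Complex.exp (z * L) := by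
    funext z
    rw [hF]
    simp only
    rw [mul_assoc, ← Complex.exp_add]
    simp
  have h2 := iteratedDeriv_polynomial_eval_zero p k
  rw [h1, iteratedDeriv_fun_mul hd.contDiff.contDiffAt
    (by have : Differentiable ℂ fun z : ℂ => Complex.exp (z * L) := by fun_prop
        exact this.contDiff.contDiffAt)] at h2
  rw [← mul_right_inj' hk, ← h2, Finset.mul_sum, Finset.mul_sum]
  refine Finset.sum_congr rfl fun j hj => ?_
  have hjk : j ≤ k := by have := Finset.mem_range.1 hj; omega
  have hj0 : (j.factorial : ℂ) ≠ 0 := by exact_mod_cast j.factorial_ne_zero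
  rw [iteratedDeriv_exp_mul_zero, Nat.descFactorial_eq_factorial_mul_choose, pow_sub₀ _ hL' hjk]
  push_cast
  field_simp

/-- The natural bound is `j ^ 2 k ^ (j - 1)`; multiplying through by `k` avoids the exponent `j - 1`
at `j = 0` and lets the induction run. -/
lemma mul_pow_sub_descFactorial_le (k j : ℕ) :
    (k : ℝ) * ((k : ℝ) ^ j - k.descFactorial j) ≤ (j : ℝ) ^ 2 * (k : ℝ) ^ j := by
  induction j with
  | zero => simp
  | succ j ih =>
    have h1 : ((k.descFactorial j : ℕ) : ℝ) ≤ (k : ℝ) ^ j := by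
      exact_mod_cast Nat.descFactorial_le_pow k j
    have h2 : ((k : ℝ) - j) * k.descFactorial j ≤ k.descFactorial (j + 1) := by
      rw [Nat.descFactorial_succ, Nat.cast_mul]
      gcongr
      have : k ≤ (k - j) + j := by omega
      have : (k : ℝ) ≤ ((k - j : ℕ) : ℝ) + j := by exact_mod_cast this
      linarith
    have hk : (0 : ℝ) ≤ k := Nat.cast_nonneg k
    have hj : (0 : ℝ) ≤ j := Nat.cast_nonneg j
    calc (k : ℝ) * ((k : ℝ) ^ (j + 1) - k.descFactorial (j + 1))
        ≤ k * ((k : ℝ) ^ (j + 1) - (k - j) * k.descFactorial j) := by gcongr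
      _ = k * (k * ((k : ℝ) ^ j - k.descFactorial j)) + k * j * k.descFactorial j := by ring
      _ ≤ k * ((j : ℝ) ^ 2 * (k : ℝ) ^ j) + k * j * (k : ℝ) ^ j := by gcongr
      _ = ((j : ℝ) ^ 2 + j) * (k : ℝ) ^ (j + 1) := by ring
      _ ≤ ((j + 1 : ℕ) : ℝ) ^ 2 * (k : ℝ) ^ (j + 1) := by
        gcongr
        push_cast
        nlinarith

/-- For `j ≤ 1` the difference is zero. For `j ≥ 2` the bound `k ^ (j - 1) / L ^ j` splits as `(k /
L) ^ (j - 2)` times `k / L ^ 2`, which is the source of the final error term. -/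
lemma abs_pow_sub_descFactorial_div_le {k : ℕ} (hk : 1 ≤ k) {L r : ℝ} (hL : 0 < L)
    (hkr : (k : ℝ) ≤ r * L) (hr : 0 < r) (j : ℕ) :
    |(k.descFactorial j / L ^ j : ℝ) - (k / L) ^ j| ≤
      (j : ℝ) ^ 2 * r ^ j / r ^ 2 * (k / L ^ 2) := by
  have hk0 : (0 : ℝ) < k := by exact_mod_cast hk
  have h1 : ((k.descFactorial j : ℕ) : ℝ) ≤ (k : ℝ) ^ j := by
    exact_mod_cast Nat.descFactorial_le_pow k j
  rw [abs_sub_comm, div_pow, ← sub_div, abs_of_nonneg (div_nonneg (sub_nonneg.2 h1) (by positivity))]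
  rcases j with _ | _ | j
  · simp
  · simp; positivity
  · have h2 := mul_pow_sub_descFactorial_le k (j + 2)
    have h3 : (k : ℝ) ^ (j + 2) - k.descFactorial (j + 2) ≤
        ((j + 2 : ℕ) : ℝ) ^ 2 * (k : ℝ) ^ (j + 1) := by
      refine le_of_mul_le_mul_left (h2.trans (le_of_eq ?_)) hk0
      ring
    calc ((k : ℝ) ^ (j + 2) - k.descFactorial (j + 2)) / L ^ (j + 2)
        ≤ ((j + 2 : ℕ) : ℝ) ^ 2 * (k : ℝ) ^ (j + 1) / L ^ (j + 2) := by gcongr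
      _ = ((j + 2 : ℕ) : ℝ) ^ 2 * (k / L) ^ j * (k / L ^ 2) := by
          rw [div_pow]; field_simp; ring
      _ ≤ ((j + 2 : ℕ) : ℝ) ^ 2 * r ^ j * (k / L ^ 2) := by
          gcongr
          rwa [div_le_iff₀ hL]
      _ = _ := by
          congr 1
          field_simp
          ring

/-- Asymptotics of the `k`-th coefficient of a polynomial `p` with `p z * exp (-z * L)` bounded. -/
theorem exists_norm_coeff_sub_le (r : ℝ) (hr : 0 < r) :
    ∃ K : ℝ, 0 < K ∧ ∀ (p : Polynomial ℂ) (L M : ℝ) (k : ℕ), 0 < L → 1 ≤ k → (k : ℝ) ≤ r * L →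
      (∀ z : ℂ, ‖z‖ = 2 * r → ‖p.eval z * Complex.exp (-(z * L))‖ ≤ M) →
      ‖p.coeff k - (L ^ k / k.factorial : ℝ) *
        (p.eval ((k / L : ℝ) : ℂ) * Complex.exp (-(((k / L : ℝ) : ℂ) * L)))‖ ≤
        K * M * (L ^ k / k.factorial * (k / L ^ 2)) := by
  have hsum : Summable fun j : ℕ => (j : ℝ) ^ 2 * (1 / 2 : ℝ) ^ j :=
    summable_pow_mul_geometric_of_norm_lt_one 2 (by norm_num)
  set T := ∑' j : ℕ, (j : ℝ) ^ 2 * (1 / 2 : ℝ) ^ j with hT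
  have hT0 : 0 ≤ T := tsum_nonneg fun _ => by positivity
  refine ⟨T / r ^ 2 + 1, by positivity, fun p L M k hL hk hkr hM => ?_⟩
  have hk0 : (0 : ℝ) < k := by exact_mod_cast hk
  have hM0 : 0 ≤ M := by
    refine (norm_nonneg _).trans (hM ((2 * r : ℝ) : ℂ) ?_)
    rw [Complex.norm_real, Real.norm_of_nonneg (by positivity)]
  rw [coeff_eq_sum_iteratedDeriv p hL k]
  set F : ℂ → ℂ := fun z => p.eval z * Complex.exp (-(z * L)) with hF
  have hd : Differentiable ℂ F := by
    have := p.differentiable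
    fun_prop
  set a : ℕ → ℂ := fun j => (j.factorial : ℂ)⁻¹ * iteratedDeriv j F 0 with ha
  -- Cauchy's estimate on radius `2r`, twice the largest possible `k / L`: against `r ^ j` it leaves
  -- the convergent series `∑ j ^ 2 / 2 ^ j`.
  have ha_le : ∀ j, ‖a j‖ ≤ M / (2 * r) ^ j := by
    intro j
    have h1 := Complex.norm_iteratedDeriv_le_of_forall_mem_sphere_norm_le (c := 0) (R := 2 * r)
      (C := M) j (by positivity) hd.diffContOnCl (fun z hz => hM z (by simpa using hz))
    have hj : (0 : ℝ) < j.factorial := by exact_mod_cast j.factorial_pos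
    rw [ha, norm_mul, norm_inv, Complex.norm_natCast, inv_mul_le_iff₀ hj]
    refine h1.trans (le_of_eq (by ring))
  have hser : HasSum (fun j => a j * (((k / L : ℝ) ^ j : ℝ) : ℂ)) (F ((k / L : ℝ) : ℂ)) := by
    refine (Complex.hasSum_taylorSeries_of_entire hd 0 ((k / L : ℝ) : ℂ)).congr_fun fun j => ?_
    rw [ha, sub_zero, smul_eq_mul, smul_eq_mul, Complex.ofReal_pow]
    ring
  have hfin : HasSum (fun j => a j * ((k.descFactorial j / L ^ j : ℝ) : ℂ))
      (∑ j ∈ Finset.range (k + 1), a j * ((k.descFactorial j / L ^ j : ℝ) : ℂ)) := by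
    refine hasSum_sum_of_ne_finset_zero fun j hj => ?_
    have : k < j := by simpa using hj
    rw [Nat.descFactorial_eq_zero_iff_lt.2 this]
    simp
  have hdiff := hfin.sub hser
  have hbound : ‖∑ j ∈ Finset.range (k + 1), a j * ((k.descFactorial j / L ^ j : ℝ) : ℂ) -
      F ((k / L : ℝ) : ℂ)‖ ≤ M / r ^ 2 * (k / L ^ 2) * T := by
    rw [← hdiff.tsum_eq]
    refine tsum_of_norm_bounded (hsum.hasSum.mul_left (M / r ^ 2 * (k / L ^ 2))) fun j => ?_
    rw [← mul_sub, ← Complex.ofReal_sub, norm_mul, Complex.norm_real, Real.norm_eq_abs]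
    calc ‖a j‖ * |(k.descFactorial j / L ^ j : ℝ) - (k / L) ^ j|
        ≤ M / (2 * r) ^ j * ((j : ℝ) ^ 2 * r ^ j / r ^ 2 * (k / L ^ 2)) := by
          gcongr
          · exact ha_le j
          · exact abs_pow_sub_descFactorial_div_le hk hL hkr hr j
      _ = _ := by
          rw [mul_pow, div_pow, one_pow]
          field_simp
  have hfac : (0 : ℝ) < L ^ k / k.factorial := by positivity
  rw [← mul_sub, norm_mul, Complex.norm_real, Real.norm_of_nonneg hfac.le]
  calc L ^ k / k.factorial * ‖∑ j ∈ Finset.range (k + 1),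
          a j * ((k.descFactorial j / L ^ j : ℝ) : ℂ) - F ((k / L : ℝ) : ℂ)‖
      ≤ L ^ k / k.factorial * (M / r ^ 2 * (k / L ^ 2) * T) := by gcongr
    _ = T / r ^ 2 * M * (L ^ k / k.factorial * (k / L ^ 2)) := by ring
    _ ≤ _ := by
        gcongr
        linarith

/-! ### The density polynomial on circles and its comparison with `ell` -/

/-- The exponential cancels the linear term of `1 + u`, leaving a quadratic error. No logarithm is
taken, since `1 + u` may vanish and `u` may be large at small primes. -/
lemma norm_one_add_mul_exp_neg_le (u : ℂ) :
    ‖(1 + u) * Complex.exp (-u)‖ ≤ Real.exp (3 * ‖u‖ ^ 2) := by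
  rcases le_or_gt ‖u‖ 1 with hu | hu
  · have h1 : (1 + u) * Complex.exp (-u) = 1 - (Complex.exp u - 1 - u) * Complex.exp (-u) := by
      have : Complex.exp u * Complex.exp (-u) = 1 := by rw [← Complex.exp_add]; simp
      linear_combination this
    have h2 : ‖Complex.exp (-u)‖ ≤ 3 := by
      refine (Complex.norm_exp_le_exp_norm _).trans ?_
      rw [norm_neg]
      exact (Real.exp_le_exp.2 hu).trans (by linarith [Real.exp_one_lt_d9])
    rw [h1]
    calc ‖1 - (Complex.exp u - 1 - u) * Complex.exp (-u)‖
        ≤ ‖(1 : ℂ)‖ + ‖(Complex.exp u - 1 - u) * Complex.exp (-u)‖ := norm_sub_le _ _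
      _ ≤ 1 + ‖u‖ ^ 2 * 3 := by
          rw [norm_one, norm_mul]
          gcongr
          exact Complex.norm_exp_sub_one_sub_id_le hu
      _ ≤ _ := by linarith [Real.add_one_le_exp (3 * ‖u‖ ^ 2)]
  · calc ‖(1 + u) * Complex.exp (-u)‖ ≤ (1 + ‖u‖) * Real.exp ‖u‖ := by
          rw [norm_mul]
          gcongr
          · exact (norm_add_le _ _).trans (by rw [norm_one])
          · exact (Complex.norm_exp_le_exp_norm _).trans (by rw [norm_neg])
      _ ≤ Real.exp ‖u‖ * Real.exp ‖u‖ := by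
          gcongr
          linarith [Real.add_one_le_exp ‖u‖]
      _ ≤ _ := by
          rw [← Real.exp_add]
          gcongr
          nlinarith

/-- `densityPoly` as a complex polynomial. -/
noncomputable def densityPolyC (y : ℝ) : Polynomial ℂ := (densityPoly y).map (algebraMap ℝ ℂ)

lemma coeff_densityPolyC (y : ℝ) (k : ℕ) :
    (densityPolyC y).coeff k = (((densityPoly y).coeff k : ℝ) : ℂ) := by
  rw [densityPolyC, Polynomial.coeff_map]; rfl

lemma eval_densityPolyC (y : ℝ) (z : ℂ) :
    (densityPolyC y).eval z = ∏ p ∈ primesLT y, (1 + (z - 1) / p) := by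
  rw [densityPolyC, densityPoly, Polynomial.map_prod, Polynomial.eval_prod]
  refine Finset.prod_congr rfl fun p _ => ?_
  simp [div_eq_mul_inv]

/-- With `w = z - 1` and `S = ∑ 1 / p`, the normalized factors `(1 + w / p) e ^ (-w / p)` have
bounded product. What is left is `e ^ (w (S - L)) e ^ (-L)`, where `S - L` is bounded and `e ^ (-L)
= 1 / log y`. -/
lemma exists_norm_eval_densityPolyC_mul_exp_le (R : ℝ) (hR : 0 ≤ R) :
    ∃ K : ℝ, 0 < K ∧ ∀ (y : ℝ) (z : ℂ), Real.exp 1 ≤ y → ‖z‖ = R →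
      ‖(densityPolyC y).eval z * Complex.exp (-(z * Real.log (Real.log y)))‖ ≤
        K / Real.log y := by
  obtain ⟨K₁, hK₁, hS⟩ := exists_abs_sum_primesLT_inv_sub_le
  have hsq : Summable fun n : ℕ => 1 / (n : ℝ) ^ 2 := Real.summable_one_div_nat_pow.2 (by norm_num)
  set T := ∑' n : ℕ, 1 / (n : ℝ) ^ 2 with hT
  set S₀ : ℝ := |mertensConst| + K₁ with hS₀
  refine ⟨Real.exp (3 * (R + 1) ^ 2 * T) * Real.exp ((R + 1) * S₀), by positivity,
    fun y z hy hz => ?_⟩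
  have hl1 := one_le_log_of_exp_one_le hy
  have hl0 : 0 < Real.log y := by linarith
  set L := Real.log (Real.log y) with hL
  set S := ∑ p ∈ primesLT y, (1 : ℝ) / p with hSdef
  have hSL : |S - L| ≤ S₀ := by
    have h1 := hS y hy
    have h2 : K₁ / Real.log y ≤ K₁ := div_le_self hK₁.le hl1
    have h3 : S - L = (S - L - mertensConst) + mertensConst := by ring
    rw [h3]
    refine (abs_add_le _ _).trans ?_
    linarith
  set w := z - 1 with hw
  have hwR : ‖w‖ ≤ R + 1 := (norm_sub_le _ _).trans (by rw [hz, norm_one])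
  have h1 : (densityPolyC y).eval z * Complex.exp (-(z * L)) =
      (∏ p ∈ primesLT y, (1 + w / p) * Complex.exp (-(w / p))) *
        Complex.exp (w * ((S - L : ℝ) : ℂ)) * ((Real.exp (-L) : ℝ) : ℂ) := by
    rw [eval_densityPolyC, Finset.prod_mul_distrib, ← Complex.exp_sum, Complex.ofReal_exp,
      mul_assoc, mul_assoc, ← Complex.exp_add, ← Complex.exp_add]
    congr 2
    have : ∑ p ∈ primesLT y, -(w / (p : ℂ)) = -(w * (S : ℂ)) := by
      rw [hSdef, Complex.ofReal_sum, Finset.mul_sum, ← Finset.sum_neg_distrib]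
      refine Finset.sum_congr rfl fun p _ => ?_
      push_cast
      ring
    rw [this, hw]
    push_cast
    ring
  have h2 : ‖∏ p ∈ primesLT y, (1 + w / p) * Complex.exp (-(w / p))‖ ≤
      Real.exp (3 * (R + 1) ^ 2 * T) := by
    rw [norm_prod]
    calc ∏ p ∈ primesLT y, ‖(1 + w / p) * Complex.exp (-(w / p))‖
        ≤ ∏ p ∈ primesLT y, Real.exp (3 * (R + 1) ^ 2 * (1 / (p : ℝ) ^ 2)) := by
          refine Finset.prod_le_prod (fun _ _ => norm_nonneg _) fun p _ => ?_
          refine (norm_one_add_mul_exp_neg_le _).trans ?_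
          rw [Real.exp_le_exp, norm_div, Complex.norm_natCast, div_pow, mul_assoc, mul_one_div]
          gcongr
      _ = Real.exp (3 * (R + 1) ^ 2 * ∑ p ∈ primesLT y, 1 / (p : ℝ) ^ 2) := by
          rw [Finset.mul_sum, Real.exp_sum]
      _ ≤ _ := by
          gcongr
          exact hsq.sum_le_tsum _ fun _ _ => by positivity
  have h3 : ‖Complex.exp (w * ((S - L : ℝ) : ℂ))‖ ≤ Real.exp ((R + 1) * S₀) := by
    refine (Complex.norm_exp_le_exp_norm _).trans ?_
    rw [norm_mul, Complex.norm_real, Real.norm_eq_abs]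
    gcongr
  rw [h1, norm_mul, norm_mul, Complex.norm_real, Real.norm_of_nonneg (Real.exp_pos _).le,
    Real.exp_neg, hL, Real.exp_log hl0, ← div_eq_mul_inv]
  gcongr

/-- The logarithm of `ell (1 + w)` for real `w ≥ -1`. -/
noncomputable def logEll (w : ℝ) : ℝ :=
  w * mertensConst + ∑' p : Nat.Primes, eulerLogError w p

lemma one_add_div_prime_pos {w : ℝ} (hw : -1 ≤ w) {p : ℕ} (hp : p.Prime) : 0 < 1 + w / p := by
  have hp2 : (2 : ℝ) ≤ p := by exact_mod_cast hp.two_le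
  have : -(1 / 2 : ℝ) ≤ w / p := by rw [le_div_iff₀ (by linarith)]; linarith
  linarith

/-- For `ρ ≥ 0` every Euler factor is positive, so logarithms are available. In each factor the
linear terms `± w / p` cancel, and the errors at `-1` combine with Euler's constant into `w *
mertensConst`. -/
lemma ell_ofReal {ρ : ℝ} (hρ : 0 ≤ ρ) : ell (ρ : ℂ) = ((Real.exp (logEll (ρ - 1)) : ℝ) : ℂ) := by
  set w := ρ - 1 with hw
  have hw1 : -1 ≤ w := by linarith
  have hs : HasSum (fun p : Nat.Primes => eulerLogError w p + w * eulerLogError (-1) p)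
      (∑' p : Nat.Primes, eulerLogError w p + w * ∑' p : Nat.Primes, eulerLogError (-1) p) :=
    (summable_eulerLogError hw1).hasSum.add
      ((summable_eulerLogError le_rfl).hasSum.mul_left w)
  have hprod := (Complex.hasSum_ofReal.2 hs).cexp
  have hfac : ∀ p : Nat.Primes, (1 + ((ρ : ℂ) - 1) / ((p : ℕ) : ℂ)) *
      (1 - 1 / ((p : ℕ) : ℂ)) ^ ((ρ : ℂ) - 1) =
      Complex.exp ((eulerLogError w p + w * eulerLogError (-1) p : ℝ) : ℂ) := by
    intro p
    have h1 := one_add_div_prime_pos hw1 p.2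
    have h2 := one_add_div_prime_pos (le_refl (-1 : ℝ)) p.2
    have h3 : (0 : ℝ) < 1 - 1 / (p : ℕ) := by rwa [neg_div, ← sub_eq_add_neg] at h2
    have h4 : eulerLogError w p + w * eulerLogError (-1) p =
        Real.log (1 + w / (p : ℕ)) + Real.log (1 - 1 / (p : ℕ)) * w := by
      rw [eulerLogError, eulerLogError, neg_div, ← sub_eq_add_neg]
      ring
    rw [h4, ← Complex.ofReal_exp, Real.exp_add, Real.exp_log h1, ← Real.rpow_def_of_pos h3,
      Complex.ofReal_mul, Complex.ofReal_cpow h3.le, hw]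
    push_cast
    rfl
  rw [ell, tprod_congr hfac]
  have := hprod.tprod_eq
  simp only [Function.comp_def] at this
  rw [this, ← Complex.exp_add, Complex.ofReal_exp, logEll, mertensConst]
  congr 1
  rw [hw]
  push_cast
  ring

/-- The lower bound matters as much as the upper one: it keeps `ell` away from `0` on `[0, r]`, so
dividing by it is harmless. -/
lemma exists_abs_logEll_le (r : ℝ) :
    ∃ K : ℝ, 0 < K ∧ ∀ ρ : ℝ, 0 ≤ ρ → ρ ≤ r → |logEll (ρ - 1)| ≤ K := by
  set T := ∑' p : Nat.Primes, 1 / ((p : ℕ) : ℝ) ^ 2 with hT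
  have hT0 : 0 ≤ T := tsum_nonneg fun _ => by positivity
  refine ⟨(1 + |r|) * |mertensConst| + 2 * (1 + |r|) ^ 2 * T + 1, by positivity, fun ρ h0 hr => ?_⟩
  have hw : |ρ - 1| ≤ 1 + |r| := by
    rw [abs_le]
    constructor <;> linarith [abs_nonneg r, le_abs_self r]
  have h1 : |∑' p : Nat.Primes, eulerLogError (ρ - 1) p| ≤ 2 * (1 + |r|) ^ 2 * T := by
    rw [← Real.norm_eq_abs]
    refine tsum_of_norm_bounded (summable_primes_inv_sq.hasSum.mul_left _) fun p => ?_
    rw [Real.norm_eq_abs]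
    refine (abs_eulerLogError_le (by linarith) p.2.two_le).trans ?_
    rw [mul_one_div, ← sq_abs (ρ - 1)]
    gcongr
  rw [logEll]
  refine (abs_add_le _ _).trans ?_
  rw [abs_mul]
  have : |ρ - 1| * |mertensConst| ≤ (1 + |r|) * |mertensConst| := by gcongr
  linarith

lemma eval_densityPolyC_mul_exp {ρ : ℝ} (hρ : 0 ≤ ρ) (y L : ℝ) :
    (densityPolyC y).eval (ρ : ℂ) * Complex.exp (-((ρ : ℂ) * L)) =
      ((Real.exp (∑ p ∈ primesLT y, eulerLogError (ρ - 1) p +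
        (ρ - 1) * ∑ p ∈ primesLT y, (1 : ℝ) / p - ρ * L) : ℝ) : ℂ) := by
  have h1 : (densityPolyC y).eval (ρ : ℂ) =
      ((∏ p ∈ primesLT y, (1 + (ρ - 1) / (p : ℝ)) : ℝ) : ℂ) := by
    rw [eval_densityPolyC]; push_cast; rfl
  have h2 : ∏ p ∈ primesLT y, (1 + (ρ - 1) / (p : ℝ)) =
      Real.exp (∑ p ∈ primesLT y, eulerLogError (ρ - 1) p +
        (ρ - 1) * ∑ p ∈ primesLT y, (1 : ℝ) / p) := by
    rw [Finset.mul_sum, ← Finset.sum_add_distrib, Real.exp_sum]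
    refine Finset.prod_congr rfl fun p hp => ?_
    rw [eulerLogError, mul_one_div, sub_add_cancel,
      Real.exp_log (one_add_div_prime_pos (by linarith) (mem_primesLT.1 hp).2)]
  rw [h1, h2, sub_eq_add_neg _ (ρ * L), Real.exp_add _ (-(ρ * L)), Complex.ofReal_mul,
    Complex.ofReal_exp (-(ρ * L))]
  push_cast
  rfl

/-- `densityPoly y` on the nonnegative reals, compared with `ell`. -/
lemma exists_abs_exp_sub_exp_logEll_le (r : ℝ) :
    ∃ K : ℝ, 0 < K ∧ ∀ y ρ : ℝ, Real.exp 1 ≤ y → 0 ≤ ρ → ρ ≤ r →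
      |Real.exp (∑ p ∈ primesLT y, eulerLogError (ρ - 1) p +
        (ρ - 1) * ∑ p ∈ primesLT y, (1 : ℝ) / p - ρ * Real.log (Real.log y)) -
        Real.exp (logEll (ρ - 1)) / Real.log y| ≤ K / Real.log y ^ 2 := by
  obtain ⟨K₁, hK₁, hS⟩ := exists_abs_sum_primesLT_inv_sub_le
  obtain ⟨K₂, hK₂, hE⟩ := exists_abs_tsum_eulerLogError_sub_sum_le
  obtain ⟨K₃, hK₃, hl⟩ := exists_abs_logEll_le r
  set W := 1 + |r| with hW
  have hW0 : 0 < W := by positivity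
  set K₄ := W * K₁ + K₂ * W ^ 2 with hK₄
  have hK₄0 : 0 < K₄ := by positivity
  refine ⟨Real.exp K₃ * (K₄ * Real.exp K₄), by positivity, fun y ρ hy h0 hr => ?_⟩
  have hl1 := one_le_log_of_exp_one_le hy
  have hl0 : 0 < Real.log y := by linarith
  have hw : |ρ - 1| ≤ W := by
    rw [abs_le]
    constructor <;> linarith [abs_nonneg r, le_abs_self r]
  -- The discrepancy of the exponents: the exponent at hand equals `logEll (ρ - 1) + η - log log y`.
  set η := (ρ - 1) * (∑ p ∈ primesLT y, (1 : ℝ) / p - Real.log (Real.log y) - mertensConst) -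
    (∑' p : Nat.Primes, eulerLogError (ρ - 1) p - ∑ p ∈ primesLT y, eulerLogError (ρ - 1) p)
    with hη
  have hη1 : |η| ≤ K₄ / Real.log y := by
    have h1 := hE y (ρ - 1) hy (by linarith)
    have h2 := hS y hy
    calc |η| ≤ |ρ - 1| * |∑ p ∈ primesLT y, (1 : ℝ) / p - Real.log (Real.log y) - mertensConst| +
          |∑' p : Nat.Primes, eulerLogError (ρ - 1) p -
            ∑ p ∈ primesLT y, eulerLogError (ρ - 1) p| := by
          rw [hη, ← abs_mul]; exact abs_sub _ _
      _ ≤ W * (K₁ / Real.log y) + K₂ * W ^ 2 / Real.log y := by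
          rw [← sq_abs (ρ - 1)] at h1
          have h3 : K₂ * |ρ - 1| ^ 2 / Real.log y ≤ K₂ * W ^ 2 / Real.log y := by gcongr
          gcongr
          exact h1.trans h3
      _ = _ := by rw [hK₄]; ring
  have hη2 : |η| ≤ K₄ := hη1.trans (div_le_self hK₄0.le hl1)
  have hexp : |Real.exp η - 1| ≤ K₄ / Real.log y * Real.exp K₄ := by
    have h1 : |Real.exp η - 1| ≤ |η| * Real.exp |η| := by
      have h2 := Real.add_one_le_exp η
      have h3 := Real.add_one_le_exp (-η)
      have h4 : (-η + 1) * Real.exp η ≤ 1 := by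
        calc (-η + 1) * Real.exp η ≤ Real.exp (-η) * Real.exp η := by gcongr
          _ = 1 := by rw [← Real.exp_add]; simp
      have h5 : η * Real.exp η ≤ |η| * Real.exp |η| := by
        calc η * Real.exp η ≤ |η| * Real.exp η := by gcongr; exact le_abs_self η
          _ ≤ _ := by gcongr; exact le_abs_self η
      have h6 : |η| ≤ |η| * Real.exp |η| :=
        le_mul_of_one_le_right (abs_nonneg _) (Real.one_le_exp (abs_nonneg _))
      rw [abs_le]
      constructor
      · linarith [neg_abs_le η]
      · linarith
    refine h1.trans ?_
    gcongr
  have hmain : Real.exp (∑ p ∈ primesLT y, eulerLogError (ρ - 1) p +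
        (ρ - 1) * ∑ p ∈ primesLT y, (1 : ℝ) / p - ρ * Real.log (Real.log y)) -
        Real.exp (logEll (ρ - 1)) / Real.log y =
      Real.exp (logEll (ρ - 1)) / Real.log y * (Real.exp η - 1) := by
    have h1 : ∑ p ∈ primesLT y, eulerLogError (ρ - 1) p +
        (ρ - 1) * ∑ p ∈ primesLT y, (1 : ℝ) / p - ρ * Real.log (Real.log y) =
        logEll (ρ - 1) + η - Real.log (Real.log y) := by
      rw [hη, logEll]; ring
    rw [h1, Real.exp_sub, Real.exp_log hl0, Real.exp_add]
    ring
  rw [hmain, abs_mul, abs_of_pos (div_pos (Real.exp_pos _) hl0)]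
  calc Real.exp (logEll (ρ - 1)) / Real.log y * |Real.exp η - 1|
      ≤ Real.exp K₃ / Real.log y * (K₄ / Real.log y * Real.exp K₄) := by
        gcongr
        exact (le_abs_self _).trans (hl ρ h0 hr)
    _ = _ := by ring

/-! ### Assembly of the estimates -/

lemma sq_le_two_mul_exp {L : ℝ} (hL : 0 ≤ L) : L ^ 2 ≤ 2 * Real.exp L := by
  have := Real.quadratic_le_exp_of_nonneg hL
  linarith

/-- The real form of the main theorem, with an additive error term. -/
theorem exists_abs_countBelow_sub_main_le (r : ℝ) (hr : 0 < r) :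
    ∃ K : ℝ, 0 < K ∧ ∀ (x y : ℝ) (k : ℕ), Real.exp 1 ≤ y → y ≤ x →
      0 < Real.log (Real.log y) → Real.log (Real.log x) < Real.log x / Real.log y →
      1 ≤ k → (k : ℝ) ≤ r * Real.log (Real.log y) →
      |(countBelow k x y : ℝ) - Real.exp (logEll (k / Real.log (Real.log y) - 1)) *
          (x / Real.log y * (Real.log (Real.log y) ^ k / k.factorial))| ≤
        K * (x / Real.log y * (Real.log (Real.log y) ^ k / k.factorial) *
          (k / Real.log (Real.log y) ^ 2)) := by
  obtain ⟨K₁, hK₁, hsieve⟩ := exists_abs_countBelow_sub_le r hr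
  obtain ⟨K₂, hK₂, hcoeff⟩ := exists_norm_coeff_sub_le r hr
  obtain ⟨K₃, hK₃, hbdd⟩ := exists_norm_eval_densityPolyC_mul_exp_le (2 * r) (by positivity)
  obtain ⟨K₄, hK₄, hell⟩ := exists_abs_exp_sub_exp_logEll_le r
  refine ⟨K₁ + K₂ * K₃ + 2 * K₄, by positivity, fun x y k hy hyx hL hα hk hkr => ?_⟩
  have hx0 : 0 < x := (Real.exp_pos 1).trans_le (hy.trans hyx)
  have hl1 := one_le_log_of_exp_one_le hy
  have hl0 : 0 < Real.log y := by linarith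
  have hexpL : Real.exp (Real.log (Real.log y)) = Real.log y := Real.exp_log hl0
  set L := Real.log (Real.log y) with hLdef
  have hk0 : (0 : ℝ) < k := by exact_mod_cast hk
  have hk1 : (1 : ℝ) ≤ k := by exact_mod_cast hk
  have hfac : (0 : ℝ) < k.factorial := by exact_mod_cast k.factorial_pos
  set ρ : ℝ := k / L with hρ
  have hρ0 : 0 < ρ := div_pos hk0 hL
  have hρr : ρ ≤ r := by rw [hρ, div_le_iff₀ hL]; exact hkr
  set W := L ^ k / k.factorial with hW
  have hW0 : 0 < W := by positivity
  set c := (densityPoly y).coeff k with hc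
  set e := Real.exp (logEll (ρ - 1)) with he
  set g := Real.exp (∑ p ∈ primesLT y, eulerLogError (ρ - 1) p +
    (ρ - 1) * ∑ p ∈ primesLT y, (1 : ℝ) / p - ρ * L) with hg
  have h1 : |(countBelow k x y : ℝ) - x * c| ≤ K₁ * (x / Real.log y * W * (k / L ^ 2)) := by
    have h := hsieve x y ρ k hy hyx hL hα hρ0.le hρr
    -- The choice `ρ = k / L` gives `W ρ ^ k = k ^ k / k! ≥ 1`, so the weighted Rankin bound is of
    -- the size of the allowed error.
    have hpow : 1 ≤ W * ρ ^ k * k := by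
      have h2 : (k.factorial : ℝ) ≤ (k : ℝ) ^ k := by exact_mod_cast Nat.factorial_le_pow k
      have h3 : W * ρ ^ k = (k : ℝ) ^ k / k.factorial := by
        rw [hW, hρ, div_pow]; field_simp
      rw [h3]
      have h4 : 1 ≤ (k : ℝ) ^ k / k.factorial := by rwa [one_le_div hfac]
      nlinarith
    have hpos : 0 < ρ ^ k * (Real.log y * L ^ 2) := by positivity
    refine le_of_mul_le_mul_right ?_ hpos
    calc |(countBelow k x y : ℝ) - x * c| * (ρ ^ k * (Real.log y * L ^ 2))
        = |(countBelow k x y : ℝ) - x * c| * ρ ^ k * (Real.log y * L ^ 2) := by ring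
      _ ≤ K₁ * x := h
      _ ≤ K₁ * x * (W * ρ ^ k * k) := le_mul_of_one_le_right (by positivity) hpow
      _ = _ := by field_simp
  have h2 : |c - W * g| ≤ K₂ * K₃ * (1 / Real.log y * W * (k / L ^ 2)) := by
    have h := hcoeff (densityPolyC y) L (K₃ / Real.log y) k hL hk hkr
      fun z hz => hbdd y z hy hz
    rw [coeff_densityPolyC, ← hρ, eval_densityPolyC_mul_exp hρ0.le, ← Complex.ofReal_mul,
      ← Complex.ofReal_sub, Complex.norm_real, Real.norm_eq_abs] at h
    refine h.trans (le_of_eq ?_)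
    ring
  have h3 : |g - e / Real.log y| ≤ 2 * K₄ * (1 / Real.log y * (k / L ^ 2)) := by
    refine (hell y ρ hy hρ0.le hρr).trans ?_
    have h4 := sq_le_two_mul_exp hL.le
    rw [hexpL] at h4
    -- Mertens' error is absorbed because `L ^ 2 ≤ 2 e ^ L = 2 log y` and `k ≥ 1`.
    have h5 : 1 / Real.log y ≤ 2 * (k / L ^ 2) := by
      rw [← mul_div_assoc, div_le_div_iff₀ hl0 (by positivity)]
      nlinarith
    calc K₄ / Real.log y ^ 2 = K₄ / Real.log y * (1 / Real.log y) := by ring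
      _ ≤ K₄ / Real.log y * (2 * (k / L ^ 2)) := by gcongr
      _ = _ := by ring
  have hsplit : (countBelow k x y : ℝ) - e * (x / Real.log y * W) =
      ((countBelow k x y : ℝ) - x * c) + x * (c - W * g) + x * W * (g - e / Real.log y) := by ring
  rw [hsplit]
  calc |((countBelow k x y : ℝ) - x * c) + x * (c - W * g) + x * W * (g - e / Real.log y)|
      ≤ |(countBelow k x y : ℝ) - x * c| + x * |c - W * g| + x * W * |g - e / Real.log y| := by
        refine (abs_add_three _ _ _).trans ?_
        rw [abs_mul x, abs_mul (x * W), abs_of_pos hx0, abs_of_pos (mul_pos hx0 hW0)]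
    _ ≤ K₁ * (x / Real.log y * W * (k / L ^ 2)) +
          x * (K₂ * K₃ * (1 / Real.log y * W * (k / L ^ 2))) +
          x * W * (2 * K₄ * (1 / Real.log y * (k / L ^ 2))) := by gcongr
    _ = _ := by ring

theorem theorem10 :
    ∃ C : ℝ, 0 < C ∧ ∀ r : ℝ, 0 < r → ∃ K : ℝ, 0 < K ∧
      ∀ (x y : ℝ) (k : ℕ), 1 < y → y ≤ x →
        C * Real.log (Real.log x) < Real.log x / Real.log y →
        1 ≤ k → (k : ℝ) ≤ r * Real.log (Real.log y) →
        ∃ ε : ℂ, ‖ε‖ ≤ K * ((k : ℝ) / Real.log (Real.log y) ^ 2) ∧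
          (countBelow k x y : ℂ) =
            ell (((k : ℝ) / Real.log (Real.log y) : ℝ) : ℂ) *
              ((x / Real.log y * (Real.log (Real.log y) ^ k / (Nat.factorial k : ℝ)) : ℝ) : ℂ) *
              (1 + ε) := by
  -- `C = 1` works for every `r`, because Rankin's parameter `c` may grow with `r` at the expense of
  -- the implied constant only.
  refine ⟨1, one_pos, fun r hr => ?_⟩
  obtain ⟨K₁, hK₁, hmain⟩ := exists_abs_countBelow_sub_main_le r hr
  obtain ⟨K₂, hK₂, hell⟩ := exists_abs_logEll_le r
  refine ⟨K₁ * Real.exp K₂, by positivity, fun x y k hy1 hyx hα hk hkr => ?_⟩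
  have hk1 : (1 : ℝ) ≤ k := by exact_mod_cast hk
  -- The conditions `1 ≤ k ≤ r log log y` already force `y > e`, so `y` close to `1` needs no
  -- separate treatment.
  have hL : 0 < Real.log (Real.log y) := by
    by_contra h
    have := mul_nonpos_of_nonneg_of_nonpos hr.le (not_lt.1 h)
    linarith
  have hl0 : 0 < Real.log y := Real.log_pos hy1
  have hl1 : 1 < Real.log y := (Real.log_pos_iff hl0.le).1 hL
  have hy : Real.exp 1 ≤ y := ((Real.lt_log_iff_exp_lt (by linarith)).1 hl1).le
  have hx0 : 0 < x := by linarith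
  rw [one_mul] at hα
  have h1 := hmain x y k hy hyx hL hα hk hkr
  set L := Real.log (Real.log y)
  set ρ : ℝ := k / L with hρ
  have hρ0 : 0 < ρ := div_pos (by linarith) hL
  have hρr : ρ ≤ r := by rw [hρ, div_le_iff₀ hL]; exact hkr
  set W := x / Real.log y * (L ^ k / k.factorial) with hW
  have hW0 : 0 < W := by positivity
  set e := Real.exp (logEll (ρ - 1)) with he
  have he0 : 0 < e := Real.exp_pos _
  have heK : 1 ≤ Real.exp K₂ * e := by
    rw [he, ← Real.exp_add]
    apply Real.one_le_exp
    linarith [neg_abs_le (logEll (ρ - 1)), hell ρ hρ0.le hρr]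
  refine ⟨((((countBelow k x y : ℝ) - e * W) / (e * W) : ℝ) : ℂ), ?_, ?_⟩
  · rw [Complex.norm_real, Real.norm_eq_abs, abs_div, abs_of_pos (mul_pos he0 hW0),
      div_le_iff₀ (mul_pos he0 hW0)]
    calc |(countBelow k x y : ℝ) - e * W| ≤ K₁ * (W * (k / L ^ 2)) := h1
      _ ≤ K₁ * (W * (k / L ^ 2)) * (Real.exp K₂ * e) :=
          le_mul_of_one_le_right (by positivity) heK
      _ = _ := by ring
  · rw [ell_ofReal hρ0.le, ← he, ← Complex.ofReal_one, ← Complex.ofReal_add, ← Complex.ofReal_mul,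
      ← Complex.ofReal_mul, ← Complex.ofReal_natCast]
    congr 1
    field_simp
    ring
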